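/- Let $g>0$. For $N\ge 2$, let $X$ be the continuous-time random walk on the complete graph $\mathbb{K}_N$ with $N$ vertices which takes steps at the events of a Poisson process of rate $1-N^{-1}$, each step being to a vertex chosen uniformly at random from all other vertices (independently of the Poisson process). Let $L_{T,v}=\int_0^T \mathbb{1}_{X(t)=v}\,dt$ be its local time at the vertex $v$. For vertices $x,y$ and $\nu\in\mathbb{R}$ let $$G_{xy}(\nu)=\int_0^\infty E_x\Big(e^{-g\sum_{v}L_{T,v}^2}\,\mathbb{1}_{X(T)=y}\Big)e^{-\nu T}\,dT,\qquad \chi_N^{\rm WSAW}(\nu)=\sum_{y\in\mathbb{K}_N}G_{xy}(\nu),$$ where the starting vertex $x$ is fixed (the sum does not depend on $x$); these quantities are finite. For $t\ge 0$ define the effective potential $$V_\nu(t)=t-\log(1+v_\nu(t)),\qquad v_\nu(t)=\int_0^\infty e^{-gs^2-\nu s}e^{-s}\sqrt{\tfrac{t}{s}}\,\tilde I_1(2\sqrt{st})\,ds,$$ where $\tilde I_1$ is the modified Bessel function of the first kind of order $1$. Write $V_\nu'$ and $V_\nu''$ for the derivatives of $V_\nu$ in $t$ (one-sided at $t=0$).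 There is a unique $\nu_c=\nu_c(g)\in\mathbb{R}$, the critical point, such that $V_{\nu_c}'(0)=0$ and $V_{\nu_c}''(0)>0$. Let $$f_0(s)=\int_0^\infty x\,e^{-\frac14x^4-\frac12 s x^2}\,dx,\qquad \lambda_1=\frac{1}{\big(\frac12V_{\nu_c}''(0)\big)^{1/2}},\qquad \lambda_2=\frac{\partial_\nu V_{\nu}'(0)\big|_{\nu=\nu_c}}{\big(\frac12V_{\nu_c}''(0)\big)^{1/2}} .$$ Then $\lambda_1$ and $\lambda_2$ are positive and, for every $s\in\mathbb{R}$, $$\lim_{N\to\infty}N^{-1/2}\,\chi_N^{\rm WSAW}(\nu_c+sN^{-1/2})=\lambda_1 f_0(\lambda_2 s).$$ -/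

import Mathlib

open MeasureTheory ProbabilityTheory Filter Topology Set
open scoped ENNReal

noncomputable section

/-!
The complete graph on `N` vertices is considered for `N ≥ 2`.  We write `N = n + 2` with `n : ℕ`;
the vertex set is `Fin (n + 2)`.
-/

/-! ### The random walk -/

/-- Sample space of the walk: the waiting times between consecutive events of the Poisson process,
and, for each event, a choice of one of the `N - 1 = n + 1` vertices other than the current one. -/
abbrev WalkSpace (n : ℕ) : Type := (ℕ → ℝ) × (ℕ → Fin (n + 1))

/-- The waiting times are i.i.d. exponential of rate `1 - N⁻¹`, the choices are i.i.d. uniform,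
and the choices are independent of the waiting times. -/
def walkMeasure (n : ℕ) : Measure (WalkSpace n) :=
  (Measure.infinitePi fun _ : ℕ => expMeasure (1 - ((n + 2 : ℕ) : ℝ)⁻¹)).prod
    (Measure.infinitePi fun _ : ℕ => (PMF.uniformOfFintype (Fin (n + 1))).toMeasure)

instance (n : ℕ) : IsProbabilityMeasure (walkMeasure n) := by
  have hr : 0 < 1 - ((n + 2 : ℕ) : ℝ)⁻¹ := by
    have h : (1 : ℝ) < ((n + 2 : ℕ) : ℝ) := by
      have : (1 : ℕ) < n + 2 := by omega
      exact_mod_cast this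
    have := inv_lt_one_of_one_lt₀ h
    linarith
  have := isProbabilityMeasure_expMeasure hr
  unfold walkMeasure
  infer_instance

/-- The vertex occupied by the walk started at `x` after `k` steps.  The map `p.succAbove` is a
bijection from `Fin (n + 1)` onto the set of vertices different from `p`, so each step goes to a
uniformly chosen vertex among all the other ones. -/
def walkVertex {n : ℕ} (x : Fin (n + 2)) (ω : WalkSpace n) : ℕ → Fin (n + 2)
  | 0 => x
  | k + 1 => (walkVertex x ω k).succAbove (ω.2 k)

/-- Time of the `(k + 1)`-st event of the Poisson process. -/
def jumpTime {n : ℕ} (ω : WalkSpace n) (k : ℕ) : ℝ :=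
  ∑ i ∈ Finset.range (k + 1), ω.1 i

/-- Number of events of the Poisson process up to time `t`. -/
def jumpCount {n : ℕ} (ω : WalkSpace n) (t : ℝ) : ℕ :=
  {k : ℕ | jumpTime ω k ≤ t}.ncard

/-- The continuous-time walk `X(t)` started at `x`. -/
def walk {n : ℕ} (x : Fin (n + 2)) (ω : WalkSpace n) (t : ℝ) : Fin (n + 2) :=
  walkVertex x ω (jumpCount ω t)

/-- The local time `L_{T,v}` at the vertex `v` up to time `T` of the walk started at `x`. -/
def localTime {n : ℕ} (x : Fin (n + 2)) (ω : WalkSpace n) (T : ℝ) (v : Fin (n + 2)) : ℝ :=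
  ∫ t in (0 : ℝ)..T, if walk x ω t = v then 1 else 0

/-! ### Two-point function and susceptibility -/

/-- The two-point function `G_{xy}(ν)`, as an integral of a nonnegative function with values in
`[0, ∞]`. -/
def twoPoint (n : ℕ) (g ν : ℝ) (x y : Fin (n + 2)) : ℝ≥0∞ :=
  ∫⁻ T in Ioi (0 : ℝ),
    (∫⁻ ω, ENNReal.ofReal
        (Real.exp (-g * ∑ v, localTime x ω T v ^ 2) * if walk x ω T = y then 1 else 0)
      ∂walkMeasure n) * ENNReal.ofReal (Real.exp (-ν * T))

/-- The susceptibility on the complete graph with `n + 2` vertices. -/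
def susceptibility (n : ℕ) (g ν : ℝ) : ℝ :=
  ∑ y : Fin (n + 2), (twoPoint n g ν 0 y).toReal

/-! ### Effective potential and critical point -/

/-- The modified Bessel function of the first kind of order `1`. -/
def besselI1 (z : ℝ) : ℝ :=
  ∑' k : ℕ, (z / 2) ^ (2 * k + 1) / ((k.factorial : ℝ) * ((k + 1).factorial : ℝ))

/-- The function `v(t)`. -/
def effV (g ν t : ℝ) : ℝ :=
  ∫ s in Ioi (0 : ℝ), Real.exp (-g * s ^ 2 - ν * s) * Real.exp (-s) *
    (√(t / s) * besselI1 (2 * √(s * t)))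

/-- The effective potential `V(t) = t - log (1 + v(t))`, considered for `t ∈ [0, ∞)`. -/
def effPotential (g ν t : ℝ) : ℝ := t - Real.log (1 + effV g ν t)

/-- `V'(0)`: the derivative of `V : [0, ∞) → ℝ` at the end point `0` (one-sided). -/
def dV0 (g ν : ℝ) : ℝ := derivWithin (effPotential g ν) (Ici 0) 0

/-- `V''(0)`: the second derivative of `V : [0, ∞) → ℝ` at `0` (one-sided). -/
def ddV0 (g ν : ℝ) : ℝ := iteratedDerivWithin 2 (effPotential g ν) (Ici 0) 0

/-- `ν` is a critical point if `V'(0) = 0` and `V''(0) > 0`. -/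
def IsCriticalPoint (g ν : ℝ) : Prop :=
  HasDerivWithinAt (effPotential g ν) 0 (Ici 0) 0 ∧ 0 < ddV0 g ν

/-! ### The profile -/

/-- The profile `f₀(s) = ∫₀^∞ x exp(-x⁴/4 - s x²/2) dx`. -/
def profile0 (s : ℝ) : ℝ :=
  ∫ x in Ioi (0 : ℝ), x * Real.exp (-(1 / 4) * x ^ 4 - (1 / 2) * s * x ^ 2)

end

noncomputable section

/-! Write N for the number of vertices and f(s) = exp(-g s² - ν s). The proof has two halves: an
exact formula 1 + χ = N ∫₀^∞ exp(-N V_ν(t)) dt, valid for every N and ν, and Laplace's method for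
that integral.

Exact formula. Since the local times sum to T, the factor exp(-ν T) is absorbed and χ is the time
integral of the expectation of ∏_v f(L_{T,v}). Let the local times start from an arbitrary vector ℓ
(`green`). Jumps from a vertex to itself change nothing, so X may be regarded as a walk of rate 1
that jumps to a uniform vertex, the current one included. Conditioning on the first jump of that
walk gives a renewal equation (`solvesRenewal_green`). It has an explicit solution. Let (Af)(s) =
∫₀^∞ e^{-u} f(s+u) du and φ_v(t) = Σ_m (t^m/m!) (A^m f)(ℓ_v). Differentiating φ_v in t is the same
as averaging it in ℓ_v, so an integration by parts in t shows that N ∫ e^{-Nt} φ_x' ∏_{v≠x} φ_v dt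
solves the equation (`solvesRenewal_prodLaplaceAt`). Solutions bounded by a multiple of exp(-Σℓ) are
unique, because each iteration of the equation halves such a bound (`SolvesRenewal.le`). At ℓ = 0
every φ_v is the power series of 1 + v_ν (`effV_eq`, `iterAvg_vertexWeight_zero`), and the formula
follows (`sum_twoPoint_add_one`).

Laplace's method. Let m_k(ν) be the moments of e^{-s} f(s) (`wmoment`). Then V'(0) = 1 - m_0 and
V''(0) = m_0² - m_1, and m_0 decreases strictly in ν with derivative -m_1; so ν_c is the unique root
of m_0 = 1. There e^{-s} f(s) and e^{-s} are two probability densities that cross once, which forces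
m_k ≤ k! and m_1 < 1. Hence V''(0) > 0, and all power series coefficients of 1 + v are at most those
of e^t, so 0 is the global minimum of V. With t = τ N^{-1/2} and ν = ν_c + s N^{-1/2}, N V_ν(t)
tends to m_1 s τ + ½(1 - m_1) τ². Dominated convergence (`exists_exp_neg_mul_egf_le`,
`tendsto_laplace`) gives a Gaussian integral over the half-line, which is the profile after the
substitution x² = 2√a τ with a = ½(1 - m_1). -/

/-! ### Exponential generating functions -/

/-- The exponential generating function of the sequence `a`. -/
def egf (a : ℕ → ℝ) (t : ℝ) : ℝ := ∑' m : ℕ, a m * t ^ m / (m.factorial : ℝ)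

lemma abs_egf_term_le {a : ℕ → ℝ} {C ρ : ℝ} (ha : ∀ m, |a m| ≤ C * ρ ^ m) (t : ℝ) (m : ℕ) :
    |a m * t ^ m / (m.factorial : ℝ)| ≤ C * ((ρ * |t|) ^ m / (m.factorial : ℝ)) := by
  rw [abs_div, abs_mul, abs_pow, Nat.abs_cast, mul_pow, ← mul_div_assoc, ← mul_assoc]
  gcongr
  exact ha m

lemma summable_egf_bound (C x : ℝ) : Summable fun m : ℕ => C * (x ^ m / (m.factorial : ℝ)) :=
  (Real.summable_pow_div_factorial x).mul_left C

lemma summable_egf {a : ℕ → ℝ} {C ρ : ℝ} (ha : ∀ m, |a m| ≤ C * ρ ^ m) (t : ℝ) :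
    Summable fun m : ℕ => a m * t ^ m / (m.factorial : ℝ) :=
  Summable.of_norm_bounded (summable_egf_bound C (ρ * |t|)) (abs_egf_term_le ha t)

lemma tsum_pow_div_factorial (x : ℝ) : ∑' m : ℕ, x ^ m / (m.factorial : ℝ) = Real.exp x := by
  rw [Real.exp_eq_exp_ℝ, NormedSpace.exp_eq_tsum_div]

lemma abs_egf_le {a : ℕ → ℝ} {C ρ : ℝ} (ha : ∀ m, |a m| ≤ C * ρ ^ m) (t : ℝ) :
    |egf a t| ≤ C * Real.exp (ρ * |t|) := by
  rw [← tsum_pow_div_factorial, ← tsum_mul_left]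
  exact tsum_of_norm_bounded (f := fun m : ℕ => a m * t ^ m / (m.factorial : ℝ))
    (summable_egf_bound C (ρ * |t|)).hasSum (abs_egf_term_le ha t)

lemma egf_zero (a : ℕ → ℝ) : egf a 0 = a 0 := by
  unfold egf
  rw [tsum_eq_single 0]
  · simp
  · intro m hm; simp [hm]

lemma geom_bound_succ {a : ℕ → ℝ} {C ρ : ℝ} (ha : ∀ m, |a m| ≤ C * ρ ^ m) (m : ℕ) :
    |a (m + 1)| ≤ C * ρ * ρ ^ m := by
  have := ha (m + 1)
  rwa [pow_succ', ← mul_assoc] at this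

/-- Differentiation shifts the coefficient sequence; the whole proof uses this rule. -/
lemma hasDerivAt_egf {a : ℕ → ℝ} {C ρ : ℝ} (hρ : 0 ≤ ρ) (ha : ∀ m, |a m| ≤ C * ρ ^ m) (t : ℝ) :
    HasDerivAt (egf a) (egf (fun m => a (m + 1)) t) t := by
  have hC : 0 ≤ C := by have := (abs_nonneg _).trans (ha 0); simpa using this
  set R := |t| + 1 with hR
  have ht : t ∈ Metric.ball (0 : ℝ) R := by simp [hR]
  let g : ℕ → ℝ → ℝ := fun m y => a m * y ^ m / (m.factorial : ℝ)
  let g' : ℕ → ℝ → ℝ := fun m y => a m * (m * y ^ (m - 1)) / (m.factorial : ℝ)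
  let u : ℕ → ℝ := fun m => C * ρ ^ m * (m * R ^ (m - 1)) / (m.factorial : ℝ)
  have hfac : ∀ m : ℕ, ((m + 1).factorial : ℝ) = (m + 1) * m.factorial := by
    intro m; rw [Nat.factorial_succ]; push_cast; ring
  have hu : Summable u := by
    rw [← summable_nat_add_iff 1]
    refine (summable_egf_bound (C * ρ) (ρ * R)).congr fun m => ?_
    have : (m.factorial : ℝ) ≠ 0 := by positivity
    have : (m : ℝ) + 1 ≠ 0 := by positivity
    simp only [u, hfac, Nat.add_sub_cancel]
    push_cast
    rw [mul_pow, pow_succ]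
    field_simp
  have key := hasDerivAt_tsum_of_isPreconnected (g := g) (g' := g') (y₀ := t) (y := t) hu
    Metric.isOpen_ball (convex_ball (0 : ℝ) R).isPreconnected
    (fun m y _ => ((hasDerivAt_pow m y).const_mul (a m)).div_const _) ?_ ht
    (summable_egf ha t) ht
  · suffices e : ∑' m, g' m t = egf (fun m => a (m + 1)) t by rw [e] at key; exact key
    have hs : Summable fun m => g' m t := by
      refine Summable.of_norm_bounded hu fun m => ?_
      simp only [g', u, Real.norm_eq_abs, abs_div, abs_mul, abs_pow, Nat.abs_cast]
      have := ha m
      have : |t| ≤ R := by simp [hR]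
      gcongr
    rw [hs.tsum_eq_zero_add]
    simp only [g', egf, Nat.cast_zero, zero_mul, mul_zero, zero_div, zero_add]
    refine tsum_congr fun m => ?_
    have : (m.factorial : ℝ) ≠ 0 := by positivity
    have : (m : ℝ) + 1 ≠ 0 := by positivity
    rw [hfac]
    push_cast
    field_simp
  · intro m y hy
    simp only [g', u, Real.norm_eq_abs, abs_div, abs_mul, abs_pow, Nat.abs_cast]
    have := ha m
    have : |y| ≤ R := by simpa using (Metric.mem_ball.1 hy).le
    gcongr

lemma continuous_egf {a : ℕ → ℝ} {C ρ : ℝ} (hρ : 0 ≤ ρ) (ha : ∀ m, |a m| ≤ C * ρ ^ m) :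
    Continuous (egf a) :=
  continuous_iff_continuousAt.2 fun t => (hasDerivAt_egf hρ ha t).continuousAt

lemma egf_nonneg {a : ℕ → ℝ} (ha : ∀ m, 0 ≤ a m) {t : ℝ} (ht : 0 ≤ t) : 0 ≤ egf a t :=
  tsum_nonneg fun m => by have := ha m; positivity

lemma egf_mono {a b : ℕ → ℝ} {C ρ C' ρ' : ℝ} (ha : ∀ m, |a m| ≤ C * ρ ^ m)
    (hb : ∀ m, |b m| ≤ C' * ρ' ^ m) (hab : ∀ m, a m ≤ b m) {t : ℝ} (ht : 0 ≤ t) :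
    egf a t ≤ egf b t :=
  Summable.tsum_le_tsum (fun m => by have := hab m; gcongr) (summable_egf ha t) (summable_egf hb t)

/-- The remainder depends on the sequence only through C and ρ, hence is uniform when ν varies with
N. -/
lemma egf_taylor {a : ℕ → ℝ} {C ρ : ℝ} (hρ : 0 ≤ ρ) (ha : ∀ m, |a m| ≤ C * ρ ^ m) {t : ℝ}
    (ht : 0 ≤ t) :
    |egf a t - (a 0 + a 1 * t + a 2 * t ^ 2 / 2)| ≤ C * ρ ^ 3 * Real.exp (ρ * t) * t ^ 3 := by
  have hC : 0 ≤ C := by have := (abs_nonneg _).trans (ha 0); simpa using this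
  have h := (summable_egf ha t).sum_add_tsum_nat_add 3
  simp only [Finset.sum_range_succ, Finset.sum_range_zero] at h
  have e : egf a t - (a 0 + a 1 * t + a 2 * t ^ 2 / 2)
      = ∑' m : ℕ, a (m + 3) * t ^ (m + 3) / ((m + 3).factorial : ℝ) := by
    rw [egf, ← h]; simp [Nat.factorial]
  rw [e]
  have hs := (summable_egf_bound (C * ρ ^ 3 * t ^ 3) (ρ * t)).hasSum
  have := tsum_of_norm_bounded
    (f := fun m : ℕ => a (m + 3) * t ^ (m + 3) / ((m + 3).factorial : ℝ)) hs ?_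
  · rw [Real.norm_eq_abs] at this
    refine this.trans (le_of_eq ?_)
    rw [tsum_mul_left, tsum_pow_div_factorial]
    ring
  · intro m
    refine (abs_egf_term_le ha t (m + 3)).trans ?_
    rw [abs_of_nonneg ht]
    have : (m.factorial : ℝ) ≤ (m + 3).factorial := by
      exact_mod_cast Nat.factorial_le (by omega)
    calc C * ((ρ * t) ^ (m + 3) / ((m + 3).factorial : ℝ))
        ≤ C * ((ρ * t) ^ (m + 3) / (m.factorial : ℝ)) := by gcongr
      _ = _ := by ring

/-! ### Moments of the single-vertex weight -/

/-- The `k`-th moment of the weight `exp (-g s² - (ν + 1) s)` on the half-line. -/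
def wmoment (g ν : ℝ) (k : ℕ) : ℝ :=
  ∫ s in Ioi (0 : ℝ), s ^ k * Real.exp (-g * s ^ 2 - (ν + 1) * s)

/-- The constant in the exponential bound for the single-vertex weight. -/
def weightConst (g ν : ℝ) : ℝ := Real.exp ((ν - 1) ^ 2 / (4 * g))

lemma weightConst_pos (g ν : ℝ) : 0 < weightConst g ν := Real.exp_pos _

lemma one_le_weightConst {g : ℝ} (hg : 0 < g) (ν : ℝ) : 1 ≤ weightConst g ν :=
  Real.one_le_exp (by positivity)

/-- Completing the square. The spare factor exp(-s) is the source of the ratio 1/2 in all later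
geometric bounds. -/
lemma weight_le {g : ℝ} (hg : 0 < g) (ν s : ℝ) :
    Real.exp (-g * s ^ 2 - ν * s) ≤ weightConst g ν * Real.exp (-s) := by
  rw [weightConst, ← Real.exp_add]
  refine Real.exp_le_exp.2 ?_
  have : (ν - 1) ^ 2 / (4 * g) + -s - (-g * s ^ 2 - ν * s)
      = (2 * g * s + (ν - 1)) ^ 2 / (4 * g) := by field_simp; ring
  have h2 : 0 ≤ (2 * g * s + (ν - 1)) ^ 2 / (4 * g) := by positivity
  linarith

lemma weight_succ_le {g : ℝ} (hg : 0 < g) (ν s : ℝ) :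
    Real.exp (-g * s ^ 2 - (ν + 1) * s) ≤ weightConst g ν * Real.exp (-(2 * s)) := by
  have h := mul_le_mul_of_nonneg_right (weight_le hg ν s) (Real.exp_pos (-s)).le
  rw [← Real.exp_add, mul_assoc, ← Real.exp_add] at h
  rw [show -g * s ^ 2 - (ν + 1) * s = -g * s ^ 2 - ν * s + -s by ring,
    show -(2 * s) = -s + -s by ring]
  exact h

lemma integral_pow_mul_exp_neg_mul (k : ℕ) {r : ℝ} (hr : 0 < r) :
    ∫ s in Ioi (0 : ℝ), s ^ k * Real.exp (-(r * s)) = k.factorial / r ^ (k + 1) := by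
  have h := Real.integral_rpow_mul_exp_neg_mul_Ioi (a := k + 1) (by positivity) hr
  rw [Real.Gamma_nat_eq_factorial] at h
  simp only [add_sub_cancel_right, Real.rpow_natCast] at h
  rw [h, one_div, ← Nat.cast_add_one, Real.rpow_natCast]
  rw [inv_pow]
  ring

lemma integrableOn_pow_mul_exp_neg_mul (k : ℕ) {r : ℝ} (hr : 0 < r) :
    IntegrableOn (fun s => s ^ k * Real.exp (-(r * s))) (Ioi (0 : ℝ)) := by
  -- A non-integrable function has integral 0 by convention, but the value is positive.
  by_contra h
  have := integral_pow_mul_exp_neg_mul k hr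
  rw [integral_undef h] at this
  have : (0 : ℝ) < k.factorial / r ^ (k + 1) := by positivity
  linarith

lemma integrableOn_wmoment {g : ℝ} (hg : 0 < g) (ν : ℝ) (k : ℕ) :
    IntegrableOn (fun s => s ^ k * Real.exp (-g * s ^ 2 - (ν + 1) * s)) (Ioi (0 : ℝ)) := by
  refine Integrable.mono' ((integrableOn_pow_mul_exp_neg_mul k two_pos).const_mul
    (weightConst g ν)) (by fun_prop) ?_
  filter_upwards [ae_restrict_mem measurableSet_Ioi] with s hs
  have hs : 0 < s := hs
  rw [Real.norm_eq_abs, abs_of_pos (by positivity)]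
  calc _ ≤ s ^ k * (weightConst g ν * Real.exp (-(2 * s))) := by
        gcongr; exact weight_succ_le hg ν s
    _ = _ := by ring

lemma wmoment_le {g : ℝ} (hg : 0 < g) (ν : ℝ) (k : ℕ) :
    wmoment g ν k ≤ weightConst g ν * (k.factorial / 2 ^ (k + 1)) := by
  rw [← integral_pow_mul_exp_neg_mul k two_pos, ← integral_const_mul]
  refine setIntegral_mono_on (integrableOn_wmoment hg ν k)
    ((integrableOn_pow_mul_exp_neg_mul k two_pos).const_mul _) measurableSet_Ioi fun s hs => ?_
  have hs : 0 < s := hs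
  calc _ ≤ s ^ k * (weightConst g ν * Real.exp (-(2 * s))) := by
        gcongr; exact weight_succ_le hg ν s
    _ = _ := by ring

lemma wmoment_pos {g : ℝ} (hg : 0 < g) (ν : ℝ) (k : ℕ) : 0 < wmoment g ν k := by
  refine (setIntegral_pos_iff_support_of_nonneg_ae ?_ (integrableOn_wmoment hg ν k)).2 ?_
  · filter_upwards [ae_restrict_mem measurableSet_Ioi] with s hs
    have hs : 0 < s := hs
    simp only [Pi.zero_apply]
    positivity
  · have : Ioi (0 : ℝ) ⊆ (Function.support fun s : ℝ =>
        s ^ k * Real.exp (-g * s ^ 2 - (ν + 1) * s)) ∩ Ioi 0 := by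
      intro s hs
      have hs' : 0 < s := hs
      exact ⟨by simp only [Function.mem_support]; positivity, hs⟩
    refine lt_of_lt_of_le ?_ (measure_mono this)
    simp

lemma wmoment_antitone {g : ℝ} (hg : 0 < g) (k : ℕ) : Antitone fun ν => wmoment g ν k := by
  intro ν μ h
  refine setIntegral_mono_on (integrableOn_wmoment hg μ k) (integrableOn_wmoment hg ν k)
    measurableSet_Ioi fun s hs => ?_
  have hs : 0 < s := hs
  gcongr

lemma hasDerivAt_wmoment {g : ℝ} (hg : 0 < g) (ν : ℝ) (k : ℕ) :
    HasDerivAt (fun ν => wmoment g ν k) (-wmoment g ν (k + 1)) ν := by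
  -- The integrand decreases in the parameter, so its value at ν - 1 dominates throughout (ν - 1,
  -- ∞).
  have key := hasDerivAt_integral_of_dominated_loc_of_deriv_le (μ := volume.restrict (Ioi (0 : ℝ)))
    (F := fun ν s => s ^ k * Real.exp (-g * s ^ 2 - (ν + 1) * s))
    (F' := fun ν s => -(s ^ (k + 1) * Real.exp (-g * s ^ 2 - (ν + 1) * s)))
    (bound := fun s => s ^ (k + 1) * Real.exp (-g * s ^ 2 - ((ν - 1) + 1) * s))
    (x₀ := ν) (s := Ioi (ν - 1)) (Ioi_mem_nhds (by linarith))
    (Eventually.of_forall fun μ => (integrableOn_wmoment hg μ k).aestronglyMeasurable)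
    (integrableOn_wmoment hg ν k) (by fun_prop) ?_ (integrableOn_wmoment hg (ν - 1) (k + 1)) ?_
  · have := key.2
    rwa [integral_neg] at this
  · filter_upwards [ae_restrict_mem measurableSet_Ioi] with s hs μ hμ
    have hs : 0 < s := hs
    have hμ : ν - 1 < μ := hμ
    rw [norm_neg, Real.norm_eq_abs, abs_of_pos (by positivity)]
    gcongr
  · filter_upwards with s μ _
    have h1 : HasDerivAt (fun μ : ℝ => -g * s ^ 2 - (μ + 1) * s) (-(1 * s)) μ :=
      (((hasDerivAt_id μ).add_const 1).mul_const s).const_sub _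
    refine (h1.exp.const_mul (s ^ k)).congr_deriv ?_
    ring

/-- From exp(δs) ≤ 1 + δ s exp(s): the factor s raises the order of the moment and exp(s) moves ν to
ν - 1. -/
lemma wmoment_sub_le {g : ℝ} (hg : 0 < g) (ν : ℝ) (k : ℕ) {δ : ℝ} (h0 : 0 ≤ δ) (h1 : δ ≤ 1) :
    wmoment g (ν - δ) k ≤ wmoment g ν k + δ * wmoment g (ν - 1) (k + 1) := by
  rw [wmoment, wmoment, wmoment, ← integral_const_mul, ← integral_add (integrableOn_wmoment hg ν k)
    ((integrableOn_wmoment hg (ν - 1) (k + 1)).const_mul δ)]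
  refine setIntegral_mono_on (integrableOn_wmoment hg (ν - δ) k)
    ((integrableOn_wmoment hg ν k).add ((integrableOn_wmoment hg (ν - 1) (k + 1)).const_mul δ))
    measurableSet_Ioi fun s hs => ?_
  have hs : 0 < s := hs
  have e1 : Real.exp (-g * s ^ 2 - (ν - δ + 1) * s)
      = Real.exp (-g * s ^ 2 - (ν + 1) * s) * Real.exp (δ * s) := by
    rw [← Real.exp_add]; ring_nf
  have e2 : Real.exp (-g * s ^ 2 - (ν - 1 + 1) * s)
      = Real.exp (-g * s ^ 2 - (ν + 1) * s) * Real.exp s := by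
    rw [← Real.exp_add]; ring_nf
  have h3 : Real.exp (δ * s) ≤ 1 + δ * s * Real.exp s := by
    have a1 : 1 - δ * s ≤ Real.exp (-(δ * s)) := by
      have := Real.add_one_le_exp (-(δ * s)); linarith
    have a2 : Real.exp (δ * s) * (1 - δ * s) ≤ 1 := by
      calc _ ≤ Real.exp (δ * s) * Real.exp (-(δ * s)) := by gcongr
        _ = 1 := by rw [← Real.exp_add]; simp
    have a3 : Real.exp (δ * s) ≤ Real.exp s := Real.exp_le_exp.2 (by nlinarith)
    have a4 : δ * s * Real.exp (δ * s) ≤ δ * s * Real.exp s := by gcongr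
    linarith
  rw [e1, e2]
  calc _ ≤ s ^ k * (Real.exp (-g * s ^ 2 - (ν + 1) * s) * (1 + δ * s * Real.exp s)) := by gcongr
    _ = _ := by ring

/-! ### The power series of the effective potential -/

/-- The coefficients of the exponential generating function `1 + v`. -/
def coeff (g ν : ℝ) : ℕ → ℝ
  | 0 => 1
  | m + 1 => wmoment g ν m / (m.factorial : ℝ)

lemma coeff_pos {g : ℝ} (hg : 0 < g) (ν : ℝ) (m : ℕ) : 0 < coeff g ν m := by
  cases m with
  | zero => exact one_pos
  | succ m => have := wmoment_pos hg ν m; simp only [coeff]; positivity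

lemma abs_coeff_le {g : ℝ} (hg : 0 < g) (ν : ℝ) (m : ℕ) :
    |coeff g ν m| ≤ weightConst g ν * (1 / 2) ^ m := by
  rw [abs_of_pos (coeff_pos hg ν m)]
  cases m with
  | zero => simpa [coeff] using one_le_weightConst hg ν
  | succ m =>
    simp only [coeff]
    have := wmoment_le hg ν m
    have hf : (0 : ℝ) < m.factorial := by positivity
    rw [div_le_iff₀ hf]
    calc _ ≤ _ := this
      _ = _ := by rw [div_pow, one_pow]; ring

lemma one_le_egf_coeff {g : ℝ} (hg : 0 < g) (ν : ℝ) {t : ℝ} (ht : 0 ≤ t) :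
    1 ≤ egf (coeff g ν) t := by
  have h := (summable_egf (abs_coeff_le hg ν) t).sum_le_tsum (Finset.range 1)
    (fun m _ => by have := coeff_pos hg ν m; positivity)
  simpa [coeff, egf] using h

lemma egf_coeff_le {g : ℝ} (hg : 0 < g) (ν : ℝ) {t : ℝ} (ht : 0 ≤ t) :
    egf (coeff g ν) t ≤ weightConst g ν * Real.exp (t / 2) := by
  have := (le_abs_self _).trans (abs_egf_le (abs_coeff_le hg ν) t)
  rwa [abs_of_nonneg ht, one_div_mul_eq_div] at this

lemma hasDerivAt_egf_coeff {g : ℝ} (hg : 0 < g) (ν t : ℝ) :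
    HasDerivAt (egf (coeff g ν)) (egf (fun m => coeff g ν (m + 1)) t) t :=
  hasDerivAt_egf (by norm_num) (abs_coeff_le hg ν) t

lemma hasDerivAt_egf_coeff_succ {g : ℝ} (hg : 0 < g) (ν t : ℝ) :
    HasDerivAt (egf (fun m => coeff g ν (m + 1))) (egf (fun m => coeff g ν (m + 2)) t) t :=
  hasDerivAt_egf (by norm_num) (geom_bound_succ (abs_coeff_le hg ν)) t

lemma sqrt_div_mul_besselI1 {s t : ℝ} (hs : 0 < s) (ht : 0 ≤ t) :
    √(t / s) * besselI1 (2 * √(s * t))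
      = ∑' k : ℕ, s ^ k * t ^ (k + 1) / ((k.factorial : ℝ) * ((k + 1).factorial : ℝ)) := by
  rw [besselI1, ← tsum_mul_left]
  refine tsum_congr fun k => ?_
  have h1 : √(t / s) * √(s * t) = t := by
    rw [← Real.sqrt_mul (by positivity), show t / s * (s * t) = t ^ 2 by field_simp,
      Real.sqrt_sq ht]
  have h2 : √(s * t) ^ 2 = s * t := Real.sq_sqrt (by positivity)
  rw [mul_div_cancel_left₀ _ (two_ne_zero' ℝ), pow_succ, pow_mul, h2, ← mul_div_assoc]
  congr 1
  calc _ = (s * t) ^ k * (√(t / s) * √(s * t)) := by ring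
    _ = _ := by rw [h1, mul_pow]; ring

/-- The Bessel series is integrated term by term. All terms are nonnegative, so summability of the
integrals of norms is convergence of the resulting series. -/
lemma effV_eq {g : ℝ} (hg : 0 < g) (ν : ℝ) {t : ℝ} (ht : 0 ≤ t) :
    effV g ν t = egf (coeff g ν) t - 1 := by
  let F : ℕ → ℝ → ℝ := fun k s => t ^ (k + 1) / ((k.factorial : ℝ) * ((k + 1).factorial : ℝ)) *
    (s ^ k * Real.exp (-g * s ^ 2 - (ν + 1) * s))
  have hF : ∀ k, IntegrableOn (F k) (Ioi 0) := fun k => (integrableOn_wmoment hg ν k).const_mul _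
  have hFi : ∀ k, ∫ s in Ioi (0 : ℝ), F k s
      = coeff g ν (k + 1) * t ^ (k + 1) / ((k + 1).factorial : ℝ) := by
    intro k
    simp only [F]
    rw [integral_const_mul]
    simp only [coeff, wmoment]
    field_simp
  have hsum : Summable fun k => coeff g ν (k + 1) * t ^ (k + 1) / ((k + 1).factorial : ℝ) :=
    (summable_nat_add_iff 1).2 (summable_egf (abs_coeff_le hg ν) t)
  have h := hasSum_integral_of_summable_integral_norm hF (by
    refine hsum.congr fun k => ?_
    rw [← hFi]
    refine setIntegral_congr_fun measurableSet_Ioi fun s hs => ?_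
    have hs : 0 < s := hs
    simp only [F]
    rw [Real.norm_eq_abs, abs_of_nonneg (by positivity)])
  have e : egf (coeff g ν) t = 1 + ∑' k, coeff g ν (k + 1) * t ^ (k + 1) / ((k + 1).factorial : ℝ) := by
    rw [egf, (summable_egf (abs_coeff_le hg ν) t).tsum_eq_zero_add]
    simp [coeff]
  rw [e, add_sub_cancel_left]
  simp_rw [← hFi]
  rw [h.tsum_eq, effV]
  refine setIntegral_congr_fun measurableSet_Ioi fun s hs => ?_
  rw [sqrt_div_mul_besselI1 hs ht, ← Real.exp_add, ← tsum_mul_left]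
  refine tsum_congr fun k => ?_
  simp only [F]
  rw [show -g * s ^ 2 - (ν + 1) * s = -g * s ^ 2 - ν * s + -s by ring]
  ring

lemma effPotential_eq {g : ℝ} (hg : 0 < g) (ν : ℝ) {t : ℝ} (ht : 0 ≤ t) :
    effPotential g ν t = t - Real.log (egf (coeff g ν) t) := by
  rw [effPotential, effV_eq hg ν ht, add_sub_cancel]

lemma hasDerivWithinAt_effPotential {g : ℝ} (hg : 0 < g) (ν : ℝ) {t : ℝ} (ht : 0 ≤ t) :
    HasDerivWithinAt (effPotential g ν)
      (1 - egf (fun m => coeff g ν (m + 1)) t / egf (coeff g ν) t) (Ici 0) t := by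
  have h1 : egf (coeff g ν) t ≠ 0 := (one_pos.trans_le (one_le_egf_coeff hg ν ht)).ne'
  have h : HasDerivAt (fun t => t - Real.log (egf (coeff g ν) t))
      (1 - egf (fun m => coeff g ν (m + 1)) t / egf (coeff g ν) t) t :=
    (hasDerivAt_id t).sub ((hasDerivAt_egf_coeff hg ν t).log h1)
  exact h.hasDerivWithinAt.congr (fun x hx => effPotential_eq hg ν hx) (effPotential_eq hg ν ht)

lemma derivWithin_effPotential {g : ℝ} (hg : 0 < g) (ν : ℝ) {t : ℝ} (ht : 0 ≤ t) :
    derivWithin (effPotential g ν) (Ici 0) t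
      = 1 - egf (fun m => coeff g ν (m + 1)) t / egf (coeff g ν) t :=
  (hasDerivWithinAt_effPotential hg ν ht).derivWithin (uniqueDiffOn_Ici 0 t ht)

lemma hasDerivWithinAt_effPotential_zero {g : ℝ} (hg : 0 < g) (ν : ℝ) :
    HasDerivWithinAt (effPotential g ν) (1 - wmoment g ν 0) (Ici 0) 0 := by
  have := hasDerivWithinAt_effPotential hg ν le_rfl
  rwa [egf_zero, egf_zero, zero_add, show coeff g ν 0 = 1 from rfl, div_one,
    show coeff g ν 1 = wmoment g ν 0 by simp [coeff]] at this

lemma dV0_eq {g : ℝ} (hg : 0 < g) (ν : ℝ) : dV0 g ν = 1 - wmoment g ν 0 :=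
  (hasDerivWithinAt_effPotential_zero hg ν).derivWithin (uniqueDiffOn_Ici 0 0 self_mem_Ici)

lemma ddV0_eq {g : ℝ} (hg : 0 < g) (ν : ℝ) :
    ddV0 g ν = wmoment g ν 0 ^ 2 - wmoment g ν 1 := by
  have h0 : egf (coeff g ν) 0 = 1 := egf_zero _
  have h1 : egf (fun m => coeff g ν (m + 1)) 0 = wmoment g ν 0 := by
    simp [egf_zero, coeff]
  have h2 : egf (fun m => coeff g ν (m + 2)) 0 = wmoment g ν 1 := by
    simp [egf_zero, coeff]
  have hd : HasDerivAt
      (fun t => 1 - egf (fun m => coeff g ν (m + 1)) t / egf (coeff g ν) t)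
      (wmoment g ν 0 ^ 2 - wmoment g ν 1) 0 := by
    refine (((hasDerivAt_egf_coeff_succ hg ν 0).div (hasDerivAt_egf_coeff hg ν 0)
      (by rw [h0]; exact one_ne_zero)).const_sub 1).congr_deriv ?_
    rw [h0, h1, h2]
    ring
  have hw : HasDerivWithinAt (derivWithin (effPotential g ν) (Ici 0))
      (wmoment g ν 0 ^ 2 - wmoment g ν 1) (Ici 0) 0 :=
    hd.hasDerivWithinAt.congr (fun x hx => derivWithin_effPotential hg ν hx)
      (derivWithin_effPotential hg ν le_rfl)
  have e : iteratedDerivWithin 1 (effPotential g ν) (Ici 0)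
      = derivWithin (effPotential g ν) (Ici 0) := by
    ext x; rw [iteratedDerivWithin_one]
  rw [ddV0, iteratedDerivWithin_succ, e]
  exact hw.derivWithin (uniqueDiffOn_Ici 0 0 self_mem_Ici)

/-! ### The critical point -/

lemma wmoment_zero_strictAnti {g : ℝ} (hg : 0 < g) : StrictAnti fun ν => wmoment g ν 0 :=
  strictAnti_of_hasDerivAt_neg (fun ν => hasDerivAt_wmoment hg ν 0)
    fun ν => neg_lt_zero.2 (wmoment_pos hg ν 1)

lemma integral_pow_mul_exp_neg (k : ℕ) :
    ∫ s in Ioi (0 : ℝ), s ^ k * Real.exp (-s) = k.factorial := by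
  simpa using integral_pow_mul_exp_neg_mul k one_pos

lemma integrableOn_pow_mul_exp_neg (k : ℕ) :
    IntegrableOn (fun s => s ^ k * Real.exp (-s)) (Ioi (0 : ℝ)) := by
  simpa using integrableOn_pow_mul_exp_neg_mul k one_pos

lemma wmoment_zero_zero_le {g : ℝ} (hg : 0 < g) : wmoment g 0 0 ≤ 1 := by
  have h := integral_pow_mul_exp_neg 0
  rw [Nat.factorial_zero, Nat.cast_one] at h
  rw [← h]
  refine setIntegral_mono_on (integrableOn_wmoment hg 0 0) (integrableOn_pow_mul_exp_neg 0)
    measurableSet_Ioi fun s hs => ?_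
  have hs : 0 < s := hs
  gcongr
  have : 0 ≤ g * s ^ 2 := by positivity
  linarith

/-- For this ν the exponent is g s(2 - s) + 2s, at least 1 on [1/2, 1]; the integrand is then at
least 2 on an interval of length 1/2. -/
lemma one_le_wmoment_zero {g : ℝ} (hg : 0 < g) : 1 ≤ wmoment g (-2 * g - 3) 0 := by
  have hvol : (volume (Ioc (1 / 2 : ℝ) 1)).toReal = 1 / 2 := by
    rw [Real.volume_Ioc, ENNReal.toReal_ofReal] <;> norm_num
  have h1 : ∫ s in Ioc (1 / 2 : ℝ) 1, (2 : ℝ) = 1 := by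
    rw [setIntegral_const, Measure.real, hvol]; norm_num
  have hsub : Ioc (1 / 2 : ℝ) 1 ⊆ Ioi 0 := fun s hs => by
    have := hs.1
    show (0 : ℝ) < s
    linarith
  rw [← h1]
  calc _ ≤ ∫ s in Ioc (1 / 2 : ℝ) 1,
        s ^ 0 * Real.exp (-g * s ^ 2 - (-2 * g - 3 + 1) * s) := by
        refine setIntegral_mono_on (integrableOn_const (by simp))
          ((integrableOn_wmoment hg _ 0).mono_set hsub) measurableSet_Ioc fun s hs => ?_
        have a1 := hs.1
        have a2 := hs.2
        have a3 : 1 ≤ -g * s ^ 2 - (-2 * g - 3 + 1) * s := by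
          have : 0 ≤ g * (s * (2 - s)) := by
            have : 0 ≤ 2 - s := by linarith
            positivity
          nlinarith
        have a4 := Real.add_one_le_exp (-g * s ^ 2 - (-2 * g - 3 + 1) * s)
        simp only [pow_zero, one_mul]
        linarith
    _ ≤ _ := by
        refine setIntegral_mono_set (integrableOn_wmoment hg _ 0) ?_ hsub.eventuallyLE
        filter_upwards [ae_restrict_mem measurableSet_Ioi] with s hs
        simp only [Pi.zero_apply, pow_zero, one_mul]
        positivity

lemma exists_wmoment_zero_eq_one {g : ℝ} (hg : 0 < g) : ∃ ν, wmoment g ν 0 = 1 := by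
  have hc : Continuous fun ν => wmoment g ν 0 :=
    continuous_iff_continuousAt.2 fun ν => (hasDerivAt_wmoment hg ν 0).continuousAt
  exact mem_range_of_exists_le_of_exists_ge hc ⟨0, wmoment_zero_zero_le hg⟩
    ⟨_, one_le_wmoment_zero hg⟩

lemma nonpos_of_wmoment_zero_eq_one {g : ℝ} (hg : 0 < g) {ν : ℝ} (h : wmoment g ν 0 = 1) :
    ν ≤ 0 := by
  by_contra! hν
  have := wmoment_zero_strictAnti hg hν
  simp only at this
  linarith [wmoment_zero_zero_le hg]

/-- The densities `exp (-g s² - (ν + 1) s)` and `exp (-s)` cross exactly once, at `s = -ν / g`. -/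
lemma crossing_nonneg {g : ℝ} (hg : 0 < g) {ν : ℝ} (hν : ν ≤ 0) (k : ℕ) {s : ℝ} (hs : 0 < s) :
    0 ≤ (s ^ k - (-ν / g) ^ k) *
      (Real.exp (-s) - Real.exp (-g * s ^ 2 - (ν + 1) * s)) := by
  have hc : 0 ≤ -ν / g := div_nonneg (by linarith) hg.le
  rcases le_total s (-ν / g) with h | h
  · have h1 : s ^ k ≤ (-ν / g) ^ k := by gcongr
    rw [le_div_iff₀ hg] at h
    have h2 : Real.exp (-s) ≤ Real.exp (-g * s ^ 2 - (ν + 1) * s) :=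
      Real.exp_le_exp.2 (by nlinarith)
    exact mul_nonneg_of_nonpos_of_nonpos (by linarith) (by linarith)
  · have h1 : (-ν / g) ^ k ≤ s ^ k := by gcongr
    rw [div_le_iff₀ hg] at h
    have h2 : Real.exp (-g * s ^ 2 - (ν + 1) * s) ≤ Real.exp (-s) :=
      Real.exp_le_exp.2 (by nlinarith)
    exact mul_nonneg (by linarith) (by linarith)

lemma integrableOn_crossing {g : ℝ} (hg : 0 < g) (ν : ℝ) (k : ℕ) :
    IntegrableOn (fun s : ℝ => (s ^ k - (-ν / g) ^ k) *
      (Real.exp (-s) - Real.exp (-g * s ^ 2 - (ν + 1) * s))) (Ioi 0) := by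
  have h := ((integrableOn_pow_mul_exp_neg k).sub (integrableOn_wmoment hg ν k)).sub
    (((integrableOn_pow_mul_exp_neg 0).sub (integrableOn_wmoment hg ν 0)).const_mul
      ((-ν / g) ^ k))
  refine h.congr_fun (fun s _ => ?_) measurableSet_Ioi
  simp only [Pi.sub_apply]
  ring

/-- Both densities have mass 1, so the constant subtracted from s^k contributes nothing. -/
lemma integral_crossing {g : ℝ} (hg : 0 < g) {ν : ℝ} (h : wmoment g ν 0 = 1) (k : ℕ) :
    ∫ s in Ioi (0 : ℝ), (s ^ k - (-ν / g) ^ k) *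
      (Real.exp (-s) - Real.exp (-g * s ^ 2 - (ν + 1) * s)) = k.factorial - wmoment g ν k := by
  have i1 := integrableOn_pow_mul_exp_neg k
  have i2 := integrableOn_wmoment hg ν k
  have i3 := integrableOn_pow_mul_exp_neg 0
  have i4 := integrableOn_wmoment hg ν 0
  have i12 : IntegrableOn (fun s => s ^ k * Real.exp (-s)
      - s ^ k * Real.exp (-g * s ^ 2 - (ν + 1) * s)) (Ioi 0) := i1.sub i2
  have i34 : IntegrableOn (fun s => s ^ 0 * Real.exp (-s)
      - s ^ 0 * Real.exp (-g * s ^ 2 - (ν + 1) * s)) (Ioi 0) := i3.sub i4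
  have e : ∫ s in Ioi (0 : ℝ), ((s ^ k * Real.exp (-s)
      - s ^ k * Real.exp (-g * s ^ 2 - (ν + 1) * s)) - (-ν / g) ^ k * (s ^ 0 * Real.exp (-s)
      - s ^ 0 * Real.exp (-g * s ^ 2 - (ν + 1) * s))) = k.factorial - wmoment g ν k := by
    rw [integral_sub i12 (i34.const_mul _), integral_sub i1 i2,
      integral_const_mul, integral_sub i3 i4, integral_pow_mul_exp_neg, integral_pow_mul_exp_neg]
    rw [wmoment] at h
    rw [h, wmoment]
    simp
  rw [← e]
  refine setIntegral_congr_fun measurableSet_Ioi fun s _ => ?_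
  ring

lemma wmoment_le_factorial {g : ℝ} (hg : 0 < g) {ν : ℝ} (h : wmoment g ν 0 = 1) (k : ℕ) :
    wmoment g ν k ≤ k.factorial := by
  have := setIntegral_nonneg (μ := volume) measurableSet_Ioi fun s (hs : s ∈ Ioi (0 : ℝ)) =>
    crossing_nonneg hg (nonpos_of_wmoment_zero_eq_one hg h) k hs
  rw [integral_crossing hg h] at this
  linarith

/-- The crossing integrand is strictly positive to the right of the crossing point. This strictness
is V''(0) > 0. -/
lemma wmoment_one_lt_one {g : ℝ} (hg : 0 < g) {ν : ℝ} (h : wmoment g ν 0 = 1) :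
    wmoment g ν 1 < 1 := by
  have hν := nonpos_of_wmoment_zero_eq_one hg h
  have hpos : 0 < ∫ s in Ioi (0 : ℝ), (s ^ 1 - (-ν / g) ^ 1) *
      (Real.exp (-s) - Real.exp (-g * s ^ 2 - (ν + 1) * s)) := by
    refine (setIntegral_pos_iff_support_of_nonneg_ae ?_ (integrableOn_crossing hg ν 1)).2 ?_
    · filter_upwards [ae_restrict_mem measurableSet_Ioi] with s hs
      exact crossing_nonneg hg hν 1 hs
    · have hc : 0 ≤ -ν / g := div_nonneg (by linarith) hg.le
      have : Ioi (-ν / g) ⊆ (Function.support fun s : ℝ => (s ^ 1 - (-ν / g) ^ 1) *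
          (Real.exp (-s) - Real.exp (-g * s ^ 2 - (ν + 1) * s))) ∩ Ioi 0 := by
        intro s hs
        have hs' : -ν / g < s := hs
        have hs0 : 0 < s := hc.trans_lt hs'
        refine ⟨?_, hs0⟩
        have h1 : 0 < s ^ 1 - (-ν / g) ^ 1 := by simpa using hs'
        rw [div_lt_iff₀ hg] at hs'
        have h2 : Real.exp (-g * s ^ 2 - (ν + 1) * s) < Real.exp (-s) :=
          Real.exp_lt_exp.2 (by nlinarith)
        simp only [Function.mem_support]
        exact (mul_pos h1 (by linarith)).ne'
      refine lt_of_lt_of_le ?_ (measure_mono this)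
      simp
  rw [integral_crossing hg h] at hpos
  simp at hpos
  linarith

/-- Coefficientwise domination by e^t: at the critical point 1 + v ≤ e^t, so V is nonnegative on the
whole half-line. -/
lemma coeff_le_one {g : ℝ} (hg : 0 < g) {ν : ℝ} (h : wmoment g ν 0 = 1) (m : ℕ) :
    coeff g ν m ≤ 1 := by
  cases m with
  | zero => exact le_rfl
  | succ m =>
    simp only [coeff]
    exact div_le_one_of_le₀ (wmoment_le_factorial hg h m) (by positivity)

/-- The condition V''(0) > 0 is automatic once V'(0) = 0. -/
lemma isCriticalPoint_iff {g : ℝ} (hg : 0 < g) (ν : ℝ) :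
    IsCriticalPoint g ν ↔ wmoment g ν 0 = 1 := by
  constructor
  · intro h
    have := (uniqueDiffOn_Ici (0 : ℝ) 0 self_mem_Ici).eq_deriv _ h.1
      (hasDerivWithinAt_effPotential_zero hg ν)
    linarith
  · intro h
    refine ⟨?_, ?_⟩
    · have := hasDerivWithinAt_effPotential_zero hg ν
      rwa [h, sub_self] at this
    · rw [ddV0_eq hg, h]
      linarith [wmoment_one_lt_one hg h]

lemma existsUnique_isCriticalPoint {g : ℝ} (hg : 0 < g) : ∃! ν : ℝ, IsCriticalPoint g ν := by
  obtain ⟨ν, hν⟩ := exists_wmoment_zero_eq_one hg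
  refine ⟨ν, (isCriticalPoint_iff hg ν).2 hν, fun μ hμ => ?_⟩
  exact (wmoment_zero_strictAnti hg).injective
    (((isCriticalPoint_iff hg μ).1 hμ).trans hν.symm)

lemma deriv_dV0 {g : ℝ} (hg : 0 < g) (ν : ℝ) :
    deriv (fun ν => dV0 g ν) ν = wmoment g ν 1 := by
  simp_rw [dV0_eq hg]
  simpa using ((hasDerivAt_wmoment hg ν 0).const_sub 1).deriv

/-! ### Laplace's method -/

lemma coeff_antitone {g : ℝ} (hg : 0 < g) (m : ℕ) : Antitone fun ν => coeff g ν m := by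
  intro ν μ h
  cases m with
  | zero => exact le_rfl
  | succ m =>
    simp only [coeff]
    have := wmoment_antitone hg m h
    simp only at this
    gcongr

lemma egf_coeff_antitone {g : ℝ} (hg : 0 < g) {t : ℝ} (ht : 0 ≤ t) :
    Antitone fun ν => egf (coeff g ν) t := fun _ _ h =>
  egf_mono (abs_coeff_le hg _) (abs_coeff_le hg _) (fun m => coeff_antitone hg m h) ht

lemma coeff_succ_sub_le {g : ℝ} (hg : 0 < g) (ν : ℝ) (m : ℕ) {δ : ℝ} (h0 : 0 ≤ δ) (h1 : δ ≤ 1) :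
    coeff g (ν - δ) (m + 1) ≤ coeff g ν (m + 1) + δ * weightConst g (ν - 1) := by
  simp only [coeff]
  have hf : (0 : ℝ) < m.factorial := by positivity
  rw [← sub_le_iff_le_add', ← sub_div, div_le_iff₀ hf]
  have h2 := wmoment_sub_le hg ν m h0 h1
  have h3 : wmoment g (ν - 1) (m + 1) ≤ weightConst g (ν - 1) * m.factorial := by
    refine (wmoment_le hg (ν - 1) (m + 1)).trans ?_
    refine mul_le_mul_of_nonneg_left ?_ (weightConst_pos _ _).le
    rw [div_le_iff₀ (by positivity), Nat.factorial_succ]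
    push_cast
    have : ((m : ℝ) + 1) ≤ 2 ^ (m + 1 + 1) := by
      have : m + 1 ≤ 2 ^ (m + 1 + 1) := (Nat.lt_two_pow_self.le).trans
        (Nat.pow_le_pow_right (by norm_num) (by omega))
      exact_mod_cast this
    calc ((m : ℝ) + 1) * m.factorial ≤ 2 ^ (m + 1 + 1) * m.factorial := by gcongr
      _ = _ := by ring
  have h4 := mul_le_mul_of_nonneg_left h3 h0
  linarith

/-- Lowering ν by δ raises each coefficient of positive index by at most D, while the gap of the
second coefficient below 1 is kept; it supplies the quadratic growth of V. -/
lemma egf_coeff_sub_le {g : ℝ} (hg : 0 < g) {ν : ℝ} (h : wmoment g ν 0 = 1) {δ t : ℝ}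
    (h0 : 0 ≤ δ) (h1 : δ ≤ 1) (ht : 0 ≤ t) :
    egf (coeff g (ν - δ)) t ≤ Real.exp t + δ * weightConst g (ν - 1) * (Real.exp t - 1)
      - (1 - wmoment g ν 1) * t ^ 2 / 2 := by
  set D := δ * weightConst g (ν - 1)
  set θ := 1 - wmoment g ν 1 with hθ
  have hexp : HasSum (fun m : ℕ => t ^ m / (m.factorial : ℝ)) (Real.exp t) := by
    rw [← tsum_pow_div_factorial]
    exact (Real.summable_pow_div_factorial t).hasSum
  -- Majorant (1 + D) e^t with two corrections: the coefficient of index 0 is exactly 1, and that of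
  -- index 2 is at most 1 + D - θ.
  have hs := ((hexp.mul_left (1 + D)).sub (hasSum_ite_eq (0 : ℕ) D)).sub
    (hasSum_ite_eq (2 : ℕ) (θ * t ^ 2 / 2))
  refine (hasSum_le (fun m => ?_) (summable_egf (abs_coeff_le hg (ν - δ)) t).hasSum hs).trans
    (le_of_eq (by ring))
  match m with
  | 0 => simp [coeff]
  | 1 =>
    have a := coeff_succ_sub_le hg ν 0 h0 h1
    have b := coeff_le_one hg h 1
    simp only [zero_add] at a
    simp only [Nat.factorial, one_ne_zero, if_false, pow_one, sub_zero,
      show (1 : ℕ) ≠ 2 by norm_num]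
    norm_num
    exact mul_le_mul_of_nonneg_right (by linarith) ht
  | 2 =>
    have a := coeff_succ_sub_le hg ν 1 h0 h1
    have b : coeff g ν 2 = 1 - θ := by simp [coeff, hθ]
    norm_num at a
    norm_num [Nat.factorial]
    have : coeff g (ν - δ) 2 * t ^ 2 ≤ (1 + D - θ) * t ^ 2 :=
      mul_le_mul_of_nonneg_right (by linarith) (by positivity)
    linarith
  | m + 3 =>
    have a := coeff_succ_sub_le hg ν (m + 2) h0 h1
    have b := coeff_le_one hg h (m + 3)
    rw [if_neg (by omega), if_neg (by omega), sub_zero, sub_zero, mul_div_assoc]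
    exact mul_le_mul_of_nonneg_right (by linarith) (by positivity)

/-- The lower bound on the effective potential in a one-sided neighbourhood of the critical
point, in exponentiated form. -/
lemma exists_exp_neg_mul_egf_le {g : ℝ} (hg : 0 < g) {ν : ℝ} (h : wmoment g ν 0 = 1) :
    ∃ D κ : ℝ, 0 < κ ∧ ∀ δ μ t : ℝ, 0 ≤ δ → δ ≤ 1 → ν - δ ≤ μ → 0 ≤ t →
      Real.exp (-t) * egf (coeff g μ) t ≤ Real.exp (D * δ * t - κ * t ^ 2) ∨
      Real.exp (-t) * egf (coeff g μ) t ≤ Real.exp (-(t / 4)) := by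
  set D := weightConst g (ν - 1)
  have hD : 0 < D := weightConst_pos _ _
  -- Beyond T the bound D exp(-t/2), which holds for every parameter above ν - 1, is at most
  -- exp(-t/4).
  set T := 4 * Real.log D with hT
  have hθ : 0 < 1 - wmoment g ν 1 := by linarith [wmoment_one_lt_one hg h]
  -- On [0, T] the quadratic gain is multiplied by exp(-t) ≥ exp(-T), whence κ.
  refine ⟨D, (1 - wmoment g ν 1) * Real.exp (-T) / 2, by positivity,
    fun δ μ t h0 h1 hμ ht => ?_⟩
  rcases le_total t T with htT | htT
  · left
    have a := (egf_coeff_antitone hg ht hμ).trans (egf_coeff_sub_le hg h h0 h1 ht)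
    have b := mul_le_mul_of_nonneg_left a (Real.exp_pos (-t)).le
    refine b.trans ?_
    have e : Real.exp (-t) * Real.exp t = 1 := by rw [← Real.exp_add]; simp
    have c1 : 1 - Real.exp (-t) ≤ t := by have := Real.add_one_le_exp (-t); linarith
    have c2 : Real.exp (-T) ≤ Real.exp (-t) := Real.exp_le_exp.2 (by linarith)
    have c3 : δ * D * (1 - Real.exp (-t)) ≤ δ * D * t := by gcongr
    have c4 : (1 - wmoment g ν 1) * t ^ 2 / 2 * Real.exp (-T)
        ≤ (1 - wmoment g ν 1) * t ^ 2 / 2 * Real.exp (-t) := by gcongr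
    have c5 := Real.add_one_le_exp
      (D * δ * t - (1 - wmoment g ν 1) * Real.exp (-T) / 2 * t ^ 2)
    calc _ = 1 + δ * D * (1 - Real.exp (-t))
          - (1 - wmoment g ν 1) * t ^ 2 / 2 * Real.exp (-t) := by
          linear_combination (1 + δ * D) * e
      _ ≤ _ := by linarith
  · right
    have a := (egf_coeff_antitone hg ht (show ν - 1 ≤ μ by linarith)).trans
      (egf_coeff_le hg (ν - 1) ht)
    have b := mul_le_mul_of_nonneg_left a (Real.exp_pos (-t)).le
    refine b.trans ?_
    rw [show weightConst g (ν - 1) = Real.exp (Real.log D) from (Real.exp_log hD).symm,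
      ← Real.exp_add, ← Real.exp_add]
    refine Real.exp_le_exp.2 ?_
    linarith

/-- Here log(1 + x) = x - x²/2 + O(x³) with x ~ τh. In the application h = N^{-1/2}, so division by
h² is multiplication by N. -/
lemma tendsto_mul_log_one_add {h x : ℕ → ℝ} {τ A : ℝ} (hh : Tendsto h atTop (𝓝 0))
    (hh0 : ∀ᶠ n in atTop, h n ≠ 0)
    (hx : Tendsto (fun n => (x n - τ * h n) / h n ^ 2) atTop (𝓝 A)) :
    Tendsto (fun n => (Real.log (1 + x n) - τ * h n) / h n ^ 2) atTop (𝓝 (A - τ ^ 2 / 2)) := by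
  have h1 : Tendsto (fun n => x n / h n) atTop (𝓝 τ) := by
    have := (hx.mul hh).add_const τ
    rw [mul_zero, zero_add] at this
    refine this.congr' ?_
    filter_upwards [hh0] with n hn
    field_simp
    ring
  have h2 : Tendsto x atTop (𝓝 0) := by
    have := h1.mul hh
    rw [mul_zero] at this
    refine this.congr' ?_
    filter_upwards [hh0] with n hn
    field_simp
  have h3 : Tendsto (fun n => |x n / h n| ^ 2 * |x n| / (1 - |x n|)) atTop (𝓝 0) := by
    have : Tendsto (fun n => |x n / h n| ^ 2 * |x n| / (1 - |x n|)) atTop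
        (𝓝 (|τ| ^ 2 * |0| / (1 - |0|))) :=
      ((h1.abs.pow 2).mul h2.abs).div (h2.abs.const_sub 1) (by simp)
    simpa using this
  have h4 : Tendsto (fun n => (Real.log (1 + x n) - x n + x n ^ 2 / 2) / h n ^ 2) atTop (𝓝 0) := by
    refine squeeze_zero_norm' ?_ h3
    have hlt : ∀ᶠ n in atTop, |x n| < 1 := by
      have := h2.abs
      rw [abs_zero] at this
      exact this.eventually_lt_const one_pos
    filter_upwards [hlt, hh0] with n hn hn0
    have := Real.abs_log_sub_add_sum_range_le (x := -x n) (by rwa [abs_neg]) 2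
    rw [abs_neg] at this
    norm_num [Finset.sum_range_succ] at this
    rw [Real.norm_eq_abs, abs_div, abs_of_pos (show 0 < h n ^ 2 by positivity),
      abs_div, div_pow, sq_abs (h n)]
    rw [show Real.log (1 + x n) - x n + x n ^ 2 / 2
      = -x n + x n ^ 2 / 2 + Real.log (1 + x n) by ring]
    calc _ ≤ |x n| ^ 3 / (1 - |x n|) / h n ^ 2 := by gcongr
      _ = _ := by ring
  have h5 := (h4.add hx).sub ((h1.pow 2).div_const 2)
  rw [zero_add] at h5
  refine h5.congr' ?_
  filter_upwards [hh0] with n hn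
  field_simp
  ring

/-- Taylor expansion to second order in t and first order in ν. The term τh cancels because the
zeroth moment is 1 at ν; its ν-derivative gives the term linear in s. -/
lemma tendsto_egf_coeff_scaled {g : ℝ} (hg : 0 < g) {ν : ℝ} (hν : wmoment g ν 0 = 1) (s : ℝ)
    {h : ℕ → ℝ} (hh : Tendsto h atTop (𝓝 0)) (hh0 : ∀ᶠ n in atTop, 0 < h n) {τ : ℝ}
    (hτ : 0 < τ) :
    Tendsto (fun n => (egf (coeff g (ν + s * h n)) (τ * h n) - 1 - τ * h n) / h n ^ 2) atTop
      (𝓝 (-(wmoment g ν 1 * s * τ) + wmoment g ν 1 * τ ^ 2 / 2)) := by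
  have hsh : Tendsto (fun n => s * h n) atTop (𝓝 0) := by simpa using hh.const_mul s
  have hne : Tendsto h atTop (𝓝[≠] 0) := tendsto_nhdsWithin_iff.2
    ⟨hh, by filter_upwards [hh0] with n hn using hn.ne'⟩
  have hd : HasDerivAt (fun u => wmoment g (ν + s * u) 0) (-wmoment g ν 1 * s) 0 := by
    have h1 : HasDerivAt (fun u : ℝ => ν + s * u) s 0 := by
      simpa using ((hasDerivAt_id (0 : ℝ)).const_mul s).const_add ν
    have h2 : HasDerivAt (fun ν => wmoment g ν 0) (-wmoment g ν 1) (ν + s * 0) := by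
      simpa using hasDerivAt_wmoment hg ν 0
    exact h2.comp (0 : ℝ) h1
  have l1 := (hd.tendsto_slope_zero.comp hne).mul_const τ
  have l2 : Tendsto (fun n => wmoment g (ν + s * h n) 1) atTop (𝓝 (wmoment g ν 1)) := by
    have hc : ContinuousAt (fun ν => wmoment g ν 1) ν := (hasDerivAt_wmoment hg ν 1).continuousAt
    refine hc.tendsto.comp ?_
    simpa using hsh.const_add ν
  have l3 : Tendsto (fun n => weightConst g (ν - 1) * (1 / 2) ^ 3 *
      Real.exp (1 / 2 * (τ * h n)) * τ ^ 3 * h n) atTop (𝓝 0) := by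
    have a : Tendsto (fun n => Real.exp (1 / 2 * (τ * h n))) atTop (𝓝 1) := by
      have := ((hh.const_mul τ).const_mul (1 / 2)).rexp
      simpa using this
    have := ((a.const_mul (weightConst g (ν - 1) * (1 / 2) ^ 3)).mul_const (τ ^ 3)).mul hh
    simpa using this
  have l4 : Tendsto (fun n => (egf (coeff g (ν + s * h n)) (τ * h n)
      - (1 + wmoment g (ν + s * h n) 0 * (τ * h n)
        + wmoment g (ν + s * h n) 1 * (τ * h n) ^ 2 / 2)) / h n ^ 2) atTop (𝓝 0) := by
    refine squeeze_zero_norm' ?_ l3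
    have hs1 : ∀ᶠ n in atTop, -1 < s * h n := hsh.eventually_const_lt (by norm_num)
    filter_upwards [hh0, hs1] with n hn hn1
    have hb : ∀ m, |coeff g (ν + s * h n) m| ≤ weightConst g (ν - 1) * (1 / 2) ^ m := by
      intro m
      have := abs_coeff_le hg (ν - 1) m
      rw [abs_of_pos (coeff_pos hg _ m)] at this ⊢
      exact (coeff_antitone hg m (show ν - 1 ≤ ν + s * h n by linarith)).trans this
    have := egf_taylor (by norm_num) hb (show 0 ≤ τ * h n by positivity)
    simp only [coeff, Nat.factorial, Nat.cast_one, div_one, mul_one] at this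
    rw [Real.norm_eq_abs, abs_div, abs_of_pos (show 0 < h n ^ 2 by positivity),
      div_le_iff₀ (by positivity)]
    calc _ ≤ _ := this
      _ = _ := by ring
  have l5 := (l4.add l1).add ((l2.mul_const (τ ^ 2)).div_const 2)
  have e : 0 + -wmoment g ν 1 * s * τ + wmoment g ν 1 * τ ^ 2 / 2
      = -(wmoment g ν 1 * s * τ) + wmoment g ν 1 * τ ^ 2 / 2 := by ring
  rw [e] at l5
  refine l5.congr' ?_
  filter_upwards [hh0] with n hn
  simp only [Function.comp_apply, zero_add, mul_zero, add_zero, hν, smul_eq_mul]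
  field_simp
  ring

/-- Substitute y = x² in the profile, then y = 2√a τ. -/
lemma integral_exp_quadratic (a c : ℝ) (ha : 0 < a) :
    ∫ τ in Ioi (0 : ℝ), Real.exp (-(c * τ) - a * τ ^ 2) = 1 / √a * profile0 (c / √a) := by
  have hra : 0 < √a := Real.sqrt_pos.2 ha
  have hsq : √a ^ 2 = a := Real.sq_sqrt ha.le
  set σ := c / √a with hσ
  have hc : c = σ * √a := by rw [hσ]; field_simp
  set G : ℝ → ℝ := fun y => Real.exp (-(1 / 4) * y ^ 2 - 1 / 2 * σ * y) with hG
  have h1 : profile0 σ = 2⁻¹ * ∫ y in Ioi (0 : ℝ), G y := by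
    rw [← integral_comp_rpow_Ioi_of_pos (g := G) two_pos, ← integral_const_mul, profile0]
    refine setIntegral_congr_fun measurableSet_Ioi fun x _ => ?_
    have e1 : x ^ ((2 : ℝ) - 1) = x := by
      rw [show (2 : ℝ) - 1 = 1 by norm_num, Real.rpow_one]
    have e2 : x ^ (2 : ℝ) = x ^ 2 := Real.rpow_two x
    simp only [hG, smul_eq_mul, e1, e2, ← pow_mul]
    ring
  have h2 := integral_comp_mul_left_Ioi G 0 (b := 2 * √a) (by positivity)
  rw [mul_zero, smul_eq_mul] at h2
  have h3 : ∫ τ in Ioi (0 : ℝ), Real.exp (-(c * τ) - a * τ ^ 2)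
      = ∫ τ in Ioi (0 : ℝ), G (2 * √a * τ) := by
    refine setIntegral_congr_fun measurableSet_Ioi fun x _ => ?_
    simp only [hG]
    congr 1
    rw [hc]
    linear_combination (-x ^ 2) * (-hsq)
  rw [h3, h2, h1]
  field_simp

lemma tendsto_laplace {g : ℝ} (hg : 0 < g) {ν : ℝ} (hν : wmoment g ν 0 = 1) (s : ℝ) :
    Tendsto (fun N : ℕ => √N * ∫ t in Ioi (0 : ℝ),
        Real.exp (-(N * t)) * egf (coeff g (ν + s * (√N)⁻¹)) t ^ N) atTop
      (𝓝 (1 / √(1 / 2 * (1 - wmoment g ν 1)) *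
        profile0 (wmoment g ν 1 * s / √(1 / 2 * (1 - wmoment g ν 1))))) := by
  have hθ : 0 < 1 - wmoment g ν 1 := by linarith [wmoment_one_lt_one hg hν]
  obtain ⟨D, κ, hκ, hbound⟩ := exists_exp_neg_mul_egf_le hg hν
  set h : ℕ → ℝ := fun N => (√N)⁻¹ with hdef
  have hsqrt : Tendsto (fun N : ℕ => √(N : ℝ)) atTop atTop :=
    Real.tendsto_sqrt_atTop.comp tendsto_natCast_atTop_atTop
  have hh : Tendsto h atTop (𝓝 0) := hsqrt.inv_tendsto_atTop
  have hh0 : ∀ᶠ N in atTop, 0 < h N := by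
    filter_upwards [eventually_ge_atTop 1] with N hN
    have : (0 : ℝ) < N := by exact_mod_cast hN
    simp only [hdef]
    positivity
  have hNh : ∀ N : ℕ, 1 ≤ N → (N : ℝ) * h N ^ 2 = 1 := by
    intro N hN
    have : (0 : ℝ) < N := by exact_mod_cast hN
    simp only [hdef, inv_pow, Real.sq_sqrt this.le]
    field_simp
  rw [← integral_exp_quadratic _ _ (by positivity)]
  have key : Tendsto (fun N : ℕ => ∫ τ in Ioi (0 : ℝ),
      (Real.exp (-(τ * h N)) * egf (coeff g (ν + s * h N)) (τ * h N)) ^ N) atTop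
      (𝓝 (∫ τ in Ioi (0 : ℝ), Real.exp (-(wmoment g ν 1 * s * τ)
        - 1 / 2 * (1 - wmoment g ν 1) * τ ^ 2))) := by
    -- The dominating function is the sum of the two alternative bounds. The Gaussian one is written
    -- as the integrand of `wmoment` with parameters κ and -D|s| - 1, whose integrability is known.
    refine tendsto_integral_filter_of_dominated_convergence
      (fun τ => τ ^ 0 * Real.exp (-κ * τ ^ 2 - (-(D * |s|) - 1 + 1) * τ)
        + τ ^ 0 * Real.exp (-(1 / 4 * τ))) ?_ ?_ ?_ ?_
    · refine Eventually.of_forall fun N => Continuous.aestronglyMeasurable ?_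
      have := continuous_egf (by norm_num) (abs_coeff_le hg (ν + s * h N))
      fun_prop
    · have hs1 : ∀ᶠ N in atTop, |s| * h N < 1 := by
        have := hh.const_mul |s|
        rw [mul_zero] at this
        exact this.eventually_lt_const one_pos
      filter_upwards [hs1, hh0, eventually_ge_atTop 1] with N hN1 hN0 hN
      filter_upwards [ae_restrict_mem measurableSet_Ioi] with τ hτ
      have hτ : 0 < τ := hτ
      have ht : 0 ≤ τ * h N := by positivity
      have hE := one_le_egf_coeff hg (ν + s * h N) ht
      have hbase : 0 ≤ Real.exp (-(τ * h N)) * egf (coeff g (ν + s * h N)) (τ * h N) := by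
        positivity
      rw [Real.norm_eq_abs, abs_of_nonneg (pow_nonneg hbase N), pow_zero, one_mul, one_mul]
      have hsN : ν - |s| * h N ≤ ν + s * h N := by nlinarith [neg_abs_le s]
      have hN2 := hNh N hN
      rcases hbound (|s| * h N) (ν + s * h N) (τ * h N) (by positivity) hN1.le hsN ht with hb | hb
      · refine (pow_le_pow_left₀ hbase hb N).trans ?_
        rw [← Real.exp_nat_mul]
        refine le_add_of_le_of_nonneg (Real.exp_le_exp.2 (le_of_eq ?_)) (Real.exp_pos _).le
        linear_combination (D * |s| * τ - κ * τ ^ 2) * hN2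
      · refine (pow_le_pow_left₀ hbase hb N).trans ?_
        rw [← Real.exp_nat_mul]
        refine le_add_of_nonneg_of_le (Real.exp_pos _).le (Real.exp_le_exp.2 ?_)
        -- In the far region N t = √N τ ≥ τ, so the N-th power is still at most exp(-τ/4).
        have hNh1 : 1 ≤ (N : ℝ) * h N := by
          have : h N ≤ 1 := inv_le_one_of_one_le₀ (by
            rw [Real.one_le_sqrt]; exact_mod_cast hN)
          have hN' : (1 : ℝ) ≤ N := by exact_mod_cast hN
          nlinarith
        nlinarith
    · exact (integrableOn_wmoment hκ _ 0).add
        (integrableOn_pow_mul_exp_neg_mul 0 (by norm_num))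
    · filter_upwards [ae_restrict_mem measurableSet_Ioi] with τ hτ
      have hτ : 0 < τ := hτ
      have l := tendsto_mul_log_one_add hh (hh0.mono fun N hN => hN.ne')
        (tendsto_egf_coeff_scaled hg hν s hh hh0 hτ)
      have l' := l.rexp
      rw [show -(wmoment g ν 1 * s * τ) + wmoment g ν 1 * τ ^ 2 / 2 - τ ^ 2 / 2
        = -(wmoment g ν 1 * s * τ) - 1 / 2 * (1 - wmoment g ν 1) * τ ^ 2 by ring] at l'
      refine l'.congr' ?_
      filter_upwards [hh0, eventually_ge_atTop 1] with N hN0 hN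
      have ht : 0 ≤ τ * h N := by positivity
      have hE := one_le_egf_coeff hg (ν + s * h N) ht
      have hN2 := hNh N hN
      rw [add_sub_cancel]
      conv_rhs => rw [← Real.exp_log (one_pos.trans_le hE), ← Real.exp_add, ← Real.exp_nat_mul]
      congr 1
      rw [div_eq_iff (by positivity)]
      linear_combination (τ * h N - Real.log (egf (coeff g (ν + s * h N)) (τ * h N))) * hN2
  refine key.congr' ?_
  filter_upwards [hh0] with N hN0
  have := integral_comp_mul_right_Ioi (fun t => Real.exp (-(N * t)) *
    egf (coeff g (ν + s * h N)) t ^ N) 0 hN0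
  rw [zero_mul, smul_eq_mul] at this
  simp only [hdef, inv_inv] at this ⊢
  rw [← this]
  refine setIntegral_congr_fun measurableSet_Ioi fun τ _ => ?_
  rw [mul_pow, ← Real.exp_nat_mul]
  congr 2
  ring

/-! ### Prepending one step to the walk -/

/-- The sequence with first term `a`, followed by `u`. -/
def consSeq {α : Type*} (a : α) (u : ℕ → α) : ℕ → α
  | 0 => a
  | k + 1 => u k

lemma measurable_consSeq {α : Type*} [MeasurableSpace α] :
    Measurable fun p : α × (ℕ → α) => consSeq p.1 p.2 := by
  refine measurable_pi_iff.2 fun k => ?_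
  cases k with
  | zero => exact measurable_fst
  | succ k => exact (measurable_pi_apply k).comp measurable_snd

lemma prod_eq_zero_mul_succ {M : Type*} [CommMonoid M] (s : Finset ℕ) (f : ℕ → M) :
    ∏ i ∈ s, f i = (if 0 ∈ s then f 0 else 1) *
      ∏ k ∈ s.preimage Nat.succ Nat.succ_injective.injOn, f (k + 1) := by
  classical
  rw [Finset.prod_preimage' Nat.succ s Nat.succ_injective.injOn f,
    ← Finset.prod_filter_mul_prod_filter_not s (fun i => i = 0)]
  congr 1
  · rw [Finset.filter_eq']
    split_ifs <;> simp
  · refine Finset.prod_congr (Finset.filter_congr fun i _ => ?_) fun _ _ => rfl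
    simp [Nat.range_succ, Nat.pos_iff_ne_zero]

/-- An i.i.d. sequence with an independent term of the same law in front is again such a sequence;
checked on cylinders. -/
lemma map_consSeq {α : Type*} [MeasurableSpace α] (μ : Measure α) [IsProbabilityMeasure μ] :
    (μ.prod (Measure.infinitePi fun _ : ℕ => μ)).map (fun p => consSeq p.1 p.2)
      = Measure.infinitePi fun _ : ℕ => μ := by
  refine Measure.eq_infinitePi (fun _ : ℕ => μ) fun s t ht => ?_
  set s' := s.preimage Nat.succ Nat.succ_injective.injOn
  set A : Set α := if 0 ∈ s then t 0 else univ
  have hpre : (fun p : α × (ℕ → α) => consSeq p.1 p.2) ⁻¹' ((s : Set ℕ).pi t)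
      = A ×ˢ ((s' : Set ℕ).pi fun k => t (k + 1)) := by
    ext p
    simp only [mem_preimage, Set.mem_pi, mem_prod, Finset.mem_coe, A, s', Finset.mem_preimage]
    constructor
    · intro h
      refine ⟨?_, fun k hk => h (k + 1) hk⟩
      split_ifs with h0
      · exact h 0 h0
      · trivial
    · rintro ⟨h0, h1⟩ i hi
      cases i with
      | zero => rw [if_pos hi] at h0; exact h0
      | succ k => exact h1 k hi
  rw [Measure.map_apply measurable_consSeq
    (MeasurableSet.pi s.countable_toSet fun i _ => ht i), hpre, Measure.prod_prod,
    Measure.infinitePi_pi _ (fun k _ => ht (k + 1)), prod_eq_zero_mul_succ s]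
  congr 1
  simp only [A]
  split_ifs <;> simp

/-- The waiting-time and step sequences obtained by prepending one waiting time and one step. -/
def consWalk {n : ℕ} (s : ℝ) (c : Fin (n + 1)) (ω : WalkSpace n) : WalkSpace n :=
  (consSeq s ω.1, consSeq c ω.2)

lemma measurable_consWalk (n : ℕ) :
    Measurable fun p : ℝ × Fin (n + 1) × WalkSpace n => consWalk p.1 p.2.1 p.2.2 := by
  refine Measurable.prodMk ?_ ?_
  · exact measurable_consSeq.comp
      (measurable_fst.prodMk (measurable_fst.comp (measurable_snd.comp measurable_snd)))
  · exact measurable_consSeq.comp ((measurable_fst.comp measurable_snd).prodMk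
      (measurable_snd.comp (measurable_snd.comp measurable_snd)))

/-- The rate of the Poisson process. -/
def rate (n : ℕ) : ℝ := 1 - ((n + 2 : ℕ) : ℝ)⁻¹

lemma rate_eq (n : ℕ) : rate n = (n + 1) / (n + 2) := by
  rw [rate]
  have : (n : ℝ) + 2 ≠ 0 := by positivity
  push_cast
  field_simp
  ring

lemma rate_pos (n : ℕ) : 0 < rate n := by
  rw [rate_eq]; positivity

lemma rate_lt_one (n : ℕ) : rate n < 1 := by
  rw [rate_eq, div_lt_one (by positivity)]; linarith

/-- The renewal property: after its first event the walk is driven by fresh data of the same law. -/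
lemma lintegral_walkMeasure (n : ℕ) {G : WalkSpace n → ℝ≥0∞} (hG : Measurable G) :
    ∫⁻ ω, G ω ∂walkMeasure n = ∫⁻ s, ∫⁻ c, ∫⁻ ω, G (consWalk s c ω) ∂walkMeasure n
      ∂(PMF.uniformOfFintype (Fin (n + 1))).toMeasure ∂expMeasure (rate n) := by
  have := isProbabilityMeasure_expMeasure (rate_pos n)
  set μ := expMeasure (rate n) with hμ
  set κ := (PMF.uniformOfFintype (Fin (n + 1))).toMeasure
  have hw : walkMeasure n = (Measure.infinitePi fun _ : ℕ => μ).prod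
    (Measure.infinitePi fun _ : ℕ => κ) := rfl
  set P := Measure.infinitePi fun _ : ℕ => μ
  set K := Measure.infinitePi fun _ : ℕ => κ
  have m1 : Measurable fun q : (ℝ × (ℕ → ℝ)) × (Fin (n + 1) × (ℕ → Fin (n + 1))) =>
      G (consSeq q.1.1 q.1.2, consSeq q.2.1 q.2.2) :=
    hG.comp ((measurable_consSeq.comp measurable_fst).prodMk
      (measurable_consSeq.comp measurable_snd))
  have e1 : ∫⁻ ω, G ω ∂walkMeasure n
      = ∫⁻ p, ∫⁻ q, G (consSeq p.1 p.2, consSeq q.1 q.2) ∂κ.prod K ∂μ.prod P := by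
    rw [hw, lintegral_prod _ hG.aemeasurable, show P = (μ.prod P).map
      (fun p => consSeq p.1 p.2) from (map_consSeq μ).symm,
      lintegral_map (Measurable.lintegral_prod_right' hG) measurable_consSeq, map_consSeq]
    refine lintegral_congr fun p => ?_
    conv_lhs => rw [show K = (κ.prod K).map (fun p => consSeq p.1 p.2) from (map_consSeq κ).symm]
    rw [lintegral_map (by fun_prop) measurable_consSeq]
  rw [e1, lintegral_prod _ (Measurable.lintegral_prod_right' m1).aemeasurable]
  refine lintegral_congr fun s => ?_
  have m2 : ∀ s : ℝ, Measurable fun q : (ℕ → ℝ) × (Fin (n + 1) × (ℕ → Fin (n + 1))) =>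
      G (consSeq s q.1, consSeq q.2.1 q.2.2) := fun s =>
    m1.comp ((measurable_const.prodMk measurable_fst).prodMk measurable_snd)
  have e2 : ∀ a : ℕ → ℝ, ∫⁻ q, G (consSeq s a, consSeq q.1 q.2) ∂κ.prod K
      = ∫⁻ c, ∫⁻ b, G (consSeq s a, consSeq c b) ∂K ∂κ := fun a =>
    lintegral_prod _ ((m2 s).comp measurable_prodMk_left).aemeasurable
  simp_rw [e2]
  have m3 : Measurable fun q : ((ℕ → ℝ) × Fin (n + 1)) × (ℕ → Fin (n + 1)) =>
      G (consSeq s q.1.1, consSeq q.1.2 q.2) :=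
    (m2 s).comp ((measurable_fst.comp measurable_fst).prodMk
      ((measurable_snd.comp measurable_fst).prodMk measurable_snd))
  rw [lintegral_lintegral_swap (Measurable.lintegral_prod_right' m3).aemeasurable]
  refine lintegral_congr fun c => ?_
  rw [hw, lintegral_prod]
  · rfl
  · exact ((m2 s).comp (measurable_fst.prodMk
      (measurable_const.prodMk measurable_snd))).aemeasurable

lemma lintegral_expMeasure {r : ℝ} (G : ℝ → ℝ≥0∞) (hG : Measurable G) :
    ∫⁻ s, G s ∂expMeasure r
      = ∫⁻ s in Ioi (0 : ℝ), ENNReal.ofReal (r * Real.exp (-(r * s))) * G s := by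
  have hd : expMeasure r = volume.withDensity (exponentialPDF r) := rfl
  have hm : Measurable (exponentialPDF r) :=
    ENNReal.measurable_ofReal.comp (measurable_exponentialPDFReal r)
  rw [hd, lintegral_withDensity_eq_lintegral_mul _ hm hG, setLIntegral_congr Ioi_ae_eq_Ici,
    ← lintegral_indicator measurableSet_Ici]
  refine lintegral_congr fun s => ?_
  rcases le_or_gt 0 s with h | h
  · rw [indicator_of_mem (show s ∈ Ici (0 : ℝ) from h), Pi.mul_apply,
      exponentialPDF_of_nonneg h]
  · rw [indicator_of_notMem (by simpa using h), Pi.mul_apply, exponentialPDF_of_neg h, zero_mul]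

lemma lintegral_Ioi_exp_neg_mul {a : ℝ} (ha : 0 < a) (c : ℝ) :
    ∫⁻ s in Ioi c, ENNReal.ofReal (Real.exp (-(a * s)))
      = ENNReal.ofReal (Real.exp (-(a * c)) / a) := by
  have h1 : IntegrableOn (fun s => Real.exp (-a * s)) (Ioi c) := exp_neg_integrableOn_Ioi c ha
  have h2 := integral_exp_mul_Ioi (show -a < 0 by linarith) c
  simp_rw [← neg_mul]
  rw [← ofReal_integral_eq_lintegral_ofReal h1 (ae_of_all _ fun s => (Real.exp_pos _).le), h2]
  congr 1
  rw [neg_div_neg_eq]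

/-! ### Regularity of the jump times -/

section cons

variable {n : ℕ} (x : Fin (n + 2)) (s : ℝ) (c : Fin (n + 1)) (ω : WalkSpace n)

lemma walkVertex_consWalk (k : ℕ) :
    walkVertex x (consWalk s c ω) (k + 1) = walkVertex (x.succAbove c) ω k := by
  induction k with
  | zero => rfl
  | succ k ih =>
    rw [walkVertex, ih]
    rfl

lemma jumpTime_consWalk_zero : jumpTime (consWalk s c ω) 0 = s := by
  simp [jumpTime, consWalk, consSeq]

lemma jumpTime_consWalk_succ (k : ℕ) :
    jumpTime (consWalk s c ω) (k + 1) = s + jumpTime ω k := by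
  rw [jumpTime, Finset.sum_range_succ', add_comm]
  rfl

end cons

lemma measurable_jumpTime (n k : ℕ) : Measurable fun ω : WalkSpace n => jumpTime ω k :=
  Finset.measurable_sum _ fun i _ => (measurable_pi_apply i).comp measurable_fst

/-- The Laplace transform at `1` of the waiting time. -/
lemma lintegral_exp_neg_expMeasure {r : ℝ} (hr : 0 < r) :
    ∫⁻ s, ENNReal.ofReal (Real.exp (-s)) ∂expMeasure r = ENNReal.ofReal (r / (r + 1)) := by
  rw [lintegral_expMeasure _ (by fun_prop)]
  have : ∀ s : ℝ, ENNReal.ofReal (r * Real.exp (-(r * s))) * ENNReal.ofReal (Real.exp (-s))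
      = ENNReal.ofReal r * ENNReal.ofReal (Real.exp (-((r + 1) * s))) := by
    intro s
    rw [← ENNReal.ofReal_mul (by positivity), ← ENNReal.ofReal_mul hr.le, mul_assoc,
      ← Real.exp_add]
    ring_nf
  simp_rw [this]
  rw [lintegral_const_mul _ (by fun_prop), lintegral_Ioi_exp_neg_mul (by linarith),
    ← ENNReal.ofReal_mul hr.le]
  simp [div_eq_mul_inv]

lemma lintegral_exp_neg_jumpTime (n k : ℕ) :
    ∫⁻ ω, ENNReal.ofReal (Real.exp (-jumpTime ω k)) ∂walkMeasure n
      = ENNReal.ofReal (rate n / (rate n + 1)) ^ (k + 1) := by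
  have := isProbabilityMeasure_expMeasure (rate_pos n)
  have hm : ∀ k, Measurable fun ω : WalkSpace n => ENNReal.ofReal (Real.exp (-jumpTime ω k)) :=
    fun k => by have := measurable_jumpTime n k; fun_prop
  induction k with
  | zero =>
    rw [lintegral_walkMeasure n (hm 0)]
    simp only [jumpTime_consWalk_zero, lintegral_const, measure_univ, mul_one]
    rw [lintegral_exp_neg_expMeasure (rate_pos n), zero_add, pow_one]
  | succ k ih =>
    rw [lintegral_walkMeasure n (hm (k + 1))]
    simp only [jumpTime_consWalk_succ, neg_add, Real.exp_add,
      ENNReal.ofReal_mul (Real.exp_pos _).le]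
    simp_rw [lintegral_const_mul _ (hm k), ih]
    simp only [lintegral_const, measure_univ, mul_one]
    rw [lintegral_mul_const _ (by fun_prop), lintegral_exp_neg_expMeasure (rate_pos n), ← pow_succ']

/-- Sample points for which waiting times are nonnegative and events do not accumulate. -/
def RegularPath {n : ℕ} (ω : WalkSpace n) : Prop :=
  (∀ i, 0 ≤ ω.1 i) ∧ ∀ t : ℝ, {k : ℕ | jumpTime ω k ≤ t}.Finite

lemma ae_nonneg_waitingTime (n : ℕ) : ∀ᵐ ω ∂walkMeasure n, ∀ i, 0 ≤ ω.1 i := by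
  have := isProbabilityMeasure_expMeasure (rate_pos n)
  rw [ae_all_iff]
  intro i
  have h0 : ∀ᵐ s ∂expMeasure (rate n), 0 ≤ s := by
    rw [ae_iff, ← lintegral_indicator_one (by measurability),
      lintegral_expMeasure _ (measurable_one.indicator (by measurability)),
      lintegral_eq_zero_iff (by
        refine Measurable.mul (by fun_prop) (measurable_one.indicator (by measurability)))]
    filter_upwards [ae_restrict_mem measurableSet_Ioi] with s hs
    have hs : 0 < s := hs
    rw [indicator_of_notMem (by simpa using hs.le)]
    simp
  have h1 : MeasurePreserving (fun ω : WalkSpace n => ω.1 i) (walkMeasure n)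
      (expMeasure (rate n)) :=
    (measurePreserving_eval_infinitePi (fun _ : ℕ => expMeasure (rate n)) i).comp
      measurePreserving_fst
  exact h1.quasiMeasurePreserving.ae h0

/-- Non-explosion: Markov's inequality for exp(-jumpTime) gives geometrically decaying
probabilities, and Borel–Cantelli applies. -/
lemma ae_finite_jumpTime_le (n : ℕ) (t : ℝ) :
    ∀ᵐ ω ∂walkMeasure n, {k : ℕ | jumpTime ω k ≤ t}.Finite := by
  have hρ : ENNReal.ofReal (rate n / (rate n + 1)) < 1 := by
    rw [ENNReal.ofReal_lt_one, div_lt_one (by linarith [rate_pos n])]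
    linarith
  set ρ := ENNReal.ofReal (rate n / (rate n + 1))
  refine ae_finite_setOfPred_mem (s := fun k => {ω : WalkSpace n | jumpTime ω k ≤ t}) ?_
  have hb : ∀ k, walkMeasure n {ω | jumpTime ω k ≤ t} ≤ ENNReal.ofReal (Real.exp t) * ρ ^ k := by
    intro k
    have h := mul_meas_ge_le_lintegral (μ := walkMeasure n)
      (f := fun ω : WalkSpace n => ENNReal.ofReal (Real.exp (-jumpTime ω k)))
      (by have := measurable_jumpTime n k; fun_prop) (ENNReal.ofReal (Real.exp (-t)))
    rw [lintegral_exp_neg_jumpTime] at h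
    have e : {ω : WalkSpace n | ENNReal.ofReal (Real.exp (-t))
        ≤ ENNReal.ofReal (Real.exp (-jumpTime ω k))} = {ω | jumpTime ω k ≤ t} := by
      ext ω
      simp [ENNReal.ofReal_le_ofReal_iff (Real.exp_pos _).le]
    rw [e] at h
    have h2 := mul_le_mul_right h (ENNReal.ofReal (Real.exp t))
    rw [← mul_assoc, ← ENNReal.ofReal_mul (Real.exp_pos _).le, ← Real.exp_add, add_neg_cancel,
      Real.exp_zero, ENNReal.ofReal_one, one_mul] at h2
    refine h2.trans ?_
    gcongr ENNReal.ofReal (Real.exp t) * ?_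
    exact pow_le_pow_right_of_le_one' hρ.le (Nat.le_succ k)
  refine ne_top_of_le_ne_top ?_ (ENNReal.tsum_le_tsum hb)
  rw [ENNReal.tsum_mul_left, ENNReal.tsum_geometric]
  refine ENNReal.mul_ne_top ENNReal.ofReal_ne_top ?_
  rw [ENNReal.inv_ne_top]
  exact (tsub_pos_of_lt hρ).ne'

lemma ae_regularPath (n : ℕ) : ∀ᵐ ω ∂walkMeasure n, RegularPath ω := by
  have h := ae_all_iff.2 fun m : ℕ => ae_finite_jumpTime_le n m
  filter_upwards [ae_nonneg_waitingTime n, h] with ω h1 h2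
  refine ⟨h1, fun t => ?_⟩
  obtain ⟨m, hm⟩ := exists_nat_ge t
  exact (h2 m).subset fun k hk => le_trans hk hm

/-! ### Measurability -/

lemma measurable_jumpCount (n : ℕ) :
    Measurable fun p : WalkSpace n × ℝ => jumpCount p.1 p.2 := by
  refine measurable_ncard.comp (measurable_set_iff.2 fun k => ?_)
  exact measurableSet_setOfPred.1
    (measurableSet_le ((measurable_jumpTime n k).comp measurable_fst) measurable_snd)

lemma measurable_walkVertex {n : ℕ} (x : Fin (n + 2)) (k : ℕ) :
    Measurable fun ω : WalkSpace n => walkVertex x ω k := by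
  induction k with
  | zero => exact measurable_const
  | succ k ih =>
    have h : Measurable fun p : Fin (n + 2) × Fin (n + 1) => p.1.succAbove p.2 :=
      measurable_of_countable _
    exact h.comp (ih.prodMk ((measurable_pi_apply k).comp measurable_snd))

lemma measurable_walk {n : ℕ} (x : Fin (n + 2)) :
    Measurable fun p : WalkSpace n × ℝ => walk x p.1 p.2 := by
  have h : Measurable fun p : WalkSpace n × ℕ => walkVertex x p.1 p.2 :=
    measurable_from_prod_countable_left fun k => measurable_walkVertex x k
  exact h.comp (measurable_fst.prodMk (measurable_jumpCount n))

lemma measurable_walk_indicator {n : ℕ} (x v : Fin (n + 2)) :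
    Measurable fun p : WalkSpace n × ℝ => if walk x p.1 p.2 = v then (1 : ℝ) else 0 :=
  Measurable.ite (measurable_walk x (measurableSet_singleton v)) measurable_const measurable_const

lemma intervalIntegrable_walk {n : ℕ} (x v : Fin (n + 2)) (ω : WalkSpace n) (a b : ℝ) :
    IntervalIntegrable (fun t => if walk x ω t = v then (1 : ℝ) else 0) volume a b := by
  refine (intervalIntegrable_const (c := (1 : ℝ))).mono_fun
    ((measurable_walk_indicator x v).comp measurable_prodMk_left).aestronglyMeasurable ?_
  filter_upwards with t
  split_ifs <;> simp

lemma measurable_localTime {n : ℕ} (x : Fin (n + 2)) :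
    Measurable fun p : WalkSpace n × ℝ => localTime x p.1 p.2 := by
  refine measurable_pi_iff.2 fun v => ?_
  have h : ∀ a b : WalkSpace n × ℝ → ℝ, Measurable a → Measurable b →
      Measurable fun p => ∫ t in Ioc (a p) (b p), if walk x p.1 t = v then (1 : ℝ) else 0 := by
    intro a b ha hb
    simp_rw [← integral_indicator measurableSet_Ioc]
    refine (StronglyMeasurable.integral_prod_right ?_).measurable
    refine Measurable.stronglyMeasurable ?_
    have hS : MeasurableSet {q : (WalkSpace n × ℝ) × ℝ | q.2 ∈ Ioc (a q.1) (b q.1)} :=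
      (measurableSet_lt (ha.comp measurable_fst) measurable_snd).inter
        (measurableSet_le measurable_snd (hb.comp measurable_fst))
    exact ((measurable_walk_indicator x v).comp
      ((measurable_fst.comp measurable_fst).prodMk measurable_snd)).indicator hS
  -- By definition an interval integral is the difference of the integrals over `Ioc 0 T` and `Ioc T
  -- 0`.
  exact (h _ _ measurable_const measurable_snd).sub (h _ _ measurable_snd measurable_const)

/-! ### The walk after its first jump -/

lemma jumpTime_nonneg {n : ℕ} {ω : WalkSpace n} (hω : RegularPath ω) (k : ℕ) : 0 ≤ jumpTime ω k :=
  Finset.sum_nonneg fun i _ => hω.1 i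

section cons

variable {n : ℕ} (x : Fin (n + 2)) {s : ℝ} (c : Fin (n + 1)) {ω : WalkSpace n} {t : ℝ}

lemma jumpCount_consWalk_of_lt (hω : RegularPath ω) (h : t < s) :
    jumpCount (consWalk s c ω) t = 0 := by
  have : {k : ℕ | jumpTime (consWalk s c ω) k ≤ t} = ∅ := by
    refine eq_empty_of_forall_notMem fun k hk => ?_
    have hk : jumpTime (consWalk s c ω) k ≤ t := hk
    cases k with
    | zero => rw [jumpTime_consWalk_zero] at hk; linarith
    | succ k => rw [jumpTime_consWalk_succ] at hk; linarith [jumpTime_nonneg hω k]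
  rw [jumpCount, this, ncard_empty]

lemma jumpCount_consWalk_of_le (hω : RegularPath ω) (h : s ≤ t) :
    jumpCount (consWalk s c ω) t = jumpCount ω (t - s) + 1 := by
  have : {k : ℕ | jumpTime (consWalk s c ω) k ≤ t}
      = insert 0 (Nat.succ '' {k : ℕ | jumpTime ω k ≤ t - s}) := by
    ext k
    cases k with
    | zero => simpa [jumpTime_consWalk_zero] using h
    | succ k => simp [jumpTime_consWalk_succ, le_sub_iff_add_le']
  -- Finiteness is essential: `ncard` of an infinite set is 0.
  rw [jumpCount, this, ncard_insert_of_notMem (by simp) ((hω.2 _).image _),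
    ncard_image_of_injective _ Nat.succ_injective, jumpCount]

lemma walk_consWalk_of_lt (hω : RegularPath ω) (h : t < s) : walk x (consWalk s c ω) t = x := by
  rw [walk, jumpCount_consWalk_of_lt c hω h, walkVertex]

lemma walk_consWalk_of_le (hω : RegularPath ω) (h : s ≤ t) :
    walk x (consWalk s c ω) t = walk (x.succAbove c) ω (t - s) := by
  rw [walk, jumpCount_consWalk_of_le c hω h, walkVertex_consWalk, walk]

lemma integral_walk_consWalk (hω : RegularPath ω) {u : ℝ} (hu : 0 ≤ u) (hus : u ≤ s)
    (v : Fin (n + 2)) :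
    ∫ t in (0 : ℝ)..u, (if walk x (consWalk s c ω) t = v then (1 : ℝ) else 0)
      = (Pi.single x u : Fin (n + 2) → ℝ) v := by
  have : ∀ᵐ t : ℝ, t ∈ Set.uIoc 0 u → (if walk x (consWalk s c ω) t = v then (1 : ℝ) else 0)
      = if x = v then 1 else 0 := by
    -- When u = s the walk has already jumped at the end point, a null set.
    have hne : ∀ᵐ t : ℝ, t ≠ s := by simp [ae_iff]
    filter_upwards [hne] with t ht htu
    rw [uIoc_of_le hu] at htu
    rw [walk_consWalk_of_lt x c hω (lt_of_le_of_ne (htu.2.trans hus) ht)]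
  rw [intervalIntegral.integral_congr_ae this, intervalIntegral.integral_const, sub_zero,
    smul_eq_mul, Pi.single_apply]
  simp [eq_comm]

lemma localTime_consWalk_of_lt (hω : RegularPath ω) (h0 : 0 ≤ t) (h : t < s) :
    localTime x (consWalk s c ω) t = Pi.single x t :=
  funext fun v => integral_walk_consWalk x c hω h0 h.le v

lemma localTime_consWalk_of_le (hω : RegularPath ω) (h0 : 0 ≤ s) (h : s ≤ t) :
    localTime x (consWalk s c ω) t = Pi.single x s + localTime (x.succAbove c) ω (t - s) := by
  funext v
  rw [localTime, ← intervalIntegral.integral_add_adjacent_intervals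
    (intervalIntegrable_walk x v _ 0 s) (intervalIntegrable_walk x v _ s t),
    integral_walk_consWalk x c hω h0 le_rfl, Pi.add_apply, localTime]
  congr 1
  have e := intervalIntegral.integral_comp_sub_right (a := s) (b := t)
    (fun u => if walk (x.succAbove c) ω u = v then (1 : ℝ) else 0) s
  rw [sub_self] at e
  rw [← e]
  refine intervalIntegral.integral_congr fun u hu => ?_
  rw [uIcc_of_le h] at hu
  rw [walk_consWalk_of_le x c hω hu.1]

end cons

/-- This identity lets exp(-νT) be distributed over the vertices. -/
lemma sum_localTime {n : ℕ} (x : Fin (n + 2)) (ω : WalkSpace n) (T : ℝ) :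
    ∑ v, localTime x ω T v = T := by
  simp only [localTime]
  rw [← intervalIntegral.integral_finsetSum fun v _ => intervalIntegrable_walk x v ω 0 T]
  simp

/-! ### Convolutions on the half-line -/

/-- Tonelli and the translation t = T - s. -/
lemma lintegral_Ioi_Ioi_sub {Ψ : ℝ → ℝ → ℝ≥0∞} (hΨ : Measurable (Function.uncurry Ψ)) :
    ∫⁻ T in Ioi (0 : ℝ), ∫⁻ s in Ioi (0 : ℝ), (if T < s then 0 else Ψ s (T - s))
      = ∫⁻ s in Ioi (0 : ℝ), ∫⁻ t in Ioi (0 : ℝ), Ψ s t := by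
  have hm : Measurable fun p : ℝ × ℝ => if p.1 < p.2 then 0 else Ψ p.2 (p.1 - p.2) :=
    Measurable.ite (measurableSet_lt measurable_fst measurable_snd) measurable_const
      (hΨ.comp (measurable_snd.prodMk (measurable_fst.sub measurable_snd)))
  rw [lintegral_lintegral_swap hm.aemeasurable]
  refine setLIntegral_congr_fun measurableSet_Ioi fun s hs => ?_
  have hs : 0 < s := hs
  rw [setLIntegral_congr (Ioi_ae_eq_Ici (a := (0 : ℝ))), setLIntegral_congr
    (Ioi_ae_eq_Ici (a := (0 : ℝ))), ← lintegral_indicator measurableSet_Ici,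
    ← lintegral_indicator measurableSet_Ici,
    ← lintegral_sub_right_eq_self ((Ici (0 : ℝ)).indicator (Ψ s)) s]
  refine lintegral_congr fun T => ?_
  by_cases h : T < s
  · rw [indicator_of_notMem (s := Ici (0 : ℝ)) (a := T - s) (by simpa using h)]
    by_cases h0 : T ∈ Ici (0 : ℝ)
    · rw [indicator_of_mem h0, if_pos h]
    · rw [indicator_of_notMem h0]
  · have h' : s ≤ T := not_lt.1 h
    rw [indicator_of_mem (s := Ici (0 : ℝ)) (a := T - s) (by simpa using h'),
      indicator_of_mem (show T ∈ Ici (0 : ℝ) from hs.le.trans h'), if_neg h]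

lemma lintegral_Ioi_ite_eq_Ioc (T : ℝ) (φ : ℝ → ℝ≥0∞) :
    ∫⁻ s in Ioi (0 : ℝ), (if T < s then 0 else φ s) = ∫⁻ s in Ioc 0 T, φ s := by
  rw [← lintegral_indicator measurableSet_Ioi, ← lintegral_indicator measurableSet_Ioc]
  refine lintegral_congr fun s => ?_
  by_cases h0 : 0 < s <;> by_cases h : T < s
  · rw [indicator_of_mem (show s ∈ Ioi (0 : ℝ) from h0), if_pos h,
      indicator_of_notMem (by simp [h])]
  · rw [indicator_of_mem (show s ∈ Ioi (0 : ℝ) from h0), if_neg h,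
      indicator_of_mem (show s ∈ Ioc 0 T from ⟨h0, not_lt.1 h⟩)]
  · rw [indicator_of_notMem (by simpa using h0), indicator_of_notMem (by simp [h0])]
  · rw [indicator_of_notMem (by simpa using h0), indicator_of_notMem (by simp [h0])]

lemma lintegral_Ioc_ofReal {T : ℝ} (hT : 0 ≤ T) {φ : ℝ → ℝ} (hφ : Continuous φ)
    (h0 : ∀ s ∈ Ioc 0 T, 0 ≤ φ s) :
    ∫⁻ s in Ioc 0 T, ENNReal.ofReal (φ s) = ENNReal.ofReal (∫ s in (0 : ℝ)..T, φ s) := by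
  rw [intervalIntegral.integral_of_le hT, ofReal_integral_eq_lintegral_ofReal]
  · exact (hφ.integrableOn_Icc).mono_set Ioc_subset_Icc_self
  · filter_upwards [ae_restrict_mem measurableSet_Ioc] with s hs using h0 s hs

/-- The resolvent identity for the exponential semigroup on the half-line. -/
lemma lintegral_exp_resolvent {r : ℝ} (hr : r < 1) {G : ℝ → ℝ≥0∞} (hG : Measurable G) :
    ∫⁻ u in Ioi (0 : ℝ), ENNReal.ofReal (Real.exp (-(r * u))) * G u
      = (∫⁻ u in Ioi (0 : ℝ), ENNReal.ofReal (Real.exp (-u)) * G u)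
        + ENNReal.ofReal (1 - r) * ∫⁻ s in Ioi (0 : ℝ), ENNReal.ofReal (Real.exp (-s)) *
          ∫⁻ t in Ioi (0 : ℝ), ENNReal.ofReal (Real.exp (-(r * t))) * G (s + t) := by
  have h1r : 0 < 1 - r := by linarith
  let Ψ : ℝ → ℝ → ℝ≥0∞ := fun s t =>
    ENNReal.ofReal (Real.exp (-s)) * (ENNReal.ofReal (Real.exp (-(r * t))) * G (s + t))
  have hΨ : Measurable (Function.uncurry Ψ) := by
    refine Measurable.mul (by fun_prop) (Measurable.mul (by fun_prop) ?_)
    exact hG.comp (measurable_fst.add measurable_snd)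
  have e1 : ∫⁻ s in Ioi (0 : ℝ), ENNReal.ofReal (Real.exp (-s)) *
      ∫⁻ t in Ioi (0 : ℝ), ENNReal.ofReal (Real.exp (-(r * t))) * G (s + t)
      = ∫⁻ s in Ioi (0 : ℝ), ∫⁻ t in Ioi (0 : ℝ), Ψ s t := by
    refine lintegral_congr fun s => ?_
    rw [← lintegral_const_mul' _ _ ENNReal.ofReal_ne_top]
  rw [e1, ← lintegral_Ioi_Ioi_sub hΨ, ← lintegral_const_mul' _ _ ENNReal.ofReal_ne_top,
    ← lintegral_add_left (by fun_prop)]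
  refine setLIntegral_congr_fun measurableSet_Ioi fun T hT => ?_
  have hT : 0 < T := hT
  rw [lintegral_Ioi_ite_eq_Ioc T]
  -- With T = s + t, G depends on T alone, and the two exponentials convolve to (e^{-rT} -
  -- e^{-T})/(1 - r).
  have e2 : ∫⁻ s in Ioc 0 T, Ψ s (T - s) = ENNReal.ofReal (∫ s in (0 : ℝ)..T,
      Real.exp (-(r * T)) * Real.exp (-(1 - r) * s)) * G T := by
    rw [← lintegral_Ioc_ofReal hT.le (by fun_prop) (fun s _ => by positivity),
      ← lintegral_mul_const _ (by fun_prop)]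
    refine lintegral_congr fun s => ?_
    simp only [Ψ]
    rw [← mul_assoc, ← ENNReal.ofReal_mul (Real.exp_pos _).le, add_sub_cancel, ← Real.exp_add,
      ← Real.exp_add]
    ring_nf
  have e3 : ∫ s in (0 : ℝ)..T, Real.exp (-(r * T)) * Real.exp (-(1 - r) * s)
      = (Real.exp (-(r * T)) - Real.exp (-T)) / (1 - r) := by
    have hd : ∀ s ∈ uIcc 0 T, HasDerivAt
        (fun s => -(Real.exp (-(r * T)) * Real.exp (-(1 - r) * s)) / (1 - r))
        (Real.exp (-(r * T)) * Real.exp (-(1 - r) * s)) s := by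
      intro s _
      have := ((((hasDerivAt_id s).const_mul (-(1 - r))).exp.const_mul
        (Real.exp (-(r * T)))).neg).div_const (1 - r)
      refine this.congr_deriv ?_
      field_simp
      simp
    rw [intervalIntegral.integral_eq_sub_of_hasDerivAt hd
      (Continuous.intervalIntegrable (by fun_prop) _ _), ← Real.exp_add]
    rw [show -(r * T) + -(1 - r) * T = -T by ring]
    simp
    ring
  have h3 : Real.exp (-T) ≤ Real.exp (-(r * T)) := Real.exp_le_exp.2 (by nlinarith)
  rw [e2, e3, ← mul_assoc, ← ENNReal.ofReal_mul h1r.le, mul_div_cancel₀ _ h1r.ne', ← add_mul,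
    ← ENNReal.ofReal_add (Real.exp_pos _).le (by linarith), add_sub_cancel]

/-! ### The Green function of the walk and its first-step equation -/

/-- The time integral of the expectation of a functional of the local times started from `ℓ`. -/
def green {n : ℕ} (F : (Fin (n + 2) → ℝ) → ℝ≥0∞) (x : Fin (n + 2)) (ℓ : Fin (n + 2) → ℝ) :
    ℝ≥0∞ :=
  ∫⁻ T in Ioi (0 : ℝ), ∫⁻ ω, F (ℓ + localTime x ω T) ∂walkMeasure n

section green

variable {n : ℕ} {F : (Fin (n + 2) → ℝ) → ℝ≥0∞}

lemma measurable_shift_localTime (hF : Measurable F) (x : Fin (n + 2)) :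
    Measurable fun p : ((Fin (n + 2) → ℝ) × ℝ) × WalkSpace n =>
      F (p.1.1 + localTime x p.2 p.1.2) :=
  hF.comp ((measurable_fst.comp measurable_fst).add ((measurable_localTime x).comp
    (measurable_snd.prodMk (measurable_snd.comp measurable_fst))))

lemma measurable_lintegral_shift (hF : Measurable F) (x : Fin (n + 2)) :
    Measurable fun p : (Fin (n + 2) → ℝ) × ℝ =>
      ∫⁻ ω, F (p.1 + localTime x ω p.2) ∂walkMeasure n :=
  Measurable.lintegral_prod_right' (measurable_shift_localTime hF x)

lemma measurable_green (hF : Measurable F) (x : Fin (n + 2)) : Measurable (green F x) :=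
  Measurable.lintegral_prod_right' (measurable_lintegral_shift hF x)

lemma measurable_add_single (x : Fin (n + 2)) (ℓ : Fin (n + 2) → ℝ) :
    Measurable fun u : ℝ => ℓ + Pi.single x u := by
  refine measurable_const.add (measurable_pi_iff.2 fun v => ?_)
  simp only [Pi.single_apply]
  split_ifs <;> fun_prop

lemma lintegral_uniform (G : Fin (n + 1) → ℝ≥0∞) :
    ∫⁻ c, G c ∂(PMF.uniformOfFintype (Fin (n + 1))).toMeasure
      = (n + 1 : ℝ≥0∞)⁻¹ * ∑ c, G c := by
  rw [lintegral_fintype, Finset.mul_sum]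
  refine Finset.sum_congr rfl fun c _ => ?_
  rw [PMF.toMeasure_apply_singleton _ _ (measurableSet_singleton c), mul_comm]
  simp

/-- Each given neighbour is reached at rate 1/N, which equals the rate of the fictitious self-jumps.
-/
lemma rate_mul_inv (n : ℕ) :
    ENNReal.ofReal (rate n) * (n + 1 : ℝ≥0∞)⁻¹ = ENNReal.ofReal (1 - rate n) := by
  have : (n + 1 : ℝ≥0∞)⁻¹ = ENNReal.ofReal ((n + 1 : ℝ)⁻¹) := by
    rw [ENNReal.ofReal_inv_of_pos (by positivity), ENNReal.ofReal_add (by positivity) zero_le_one]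
    simp
  rw [this, ← ENNReal.ofReal_mul (rate_pos n).le, rate_eq]
  congr 1
  field_simp
  ring

lemma measurable_lintegral_consWalk (hF : Measurable F) (x : Fin (n + 2)) (ℓ : Fin (n + 2) → ℝ)
    (T : ℝ) : Measurable fun s => ∫⁻ c, ∫⁻ ω, F (ℓ + localTime x (consWalk s c ω) T)
      ∂walkMeasure n ∂(PMF.uniformOfFintype (Fin (n + 1))).toMeasure := by
  have hm : Measurable fun q : (ℝ × Fin (n + 1)) × WalkSpace n =>
      F (ℓ + localTime x (consWalk q.1.1 q.1.2 q.2) T) := by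
    have h1 : Measurable fun q : (ℝ × Fin (n + 1)) × WalkSpace n =>
        consWalk q.1.1 q.1.2 q.2 := (measurable_consWalk n).comp
      ((measurable_fst.comp measurable_fst).prodMk
        ((measurable_snd.comp measurable_fst).prodMk measurable_snd))
    exact hF.comp (measurable_const.add
      ((measurable_localTime x).comp (h1.prodMk measurable_const)))
  exact Measurable.lintegral_prod_right' (Measurable.lintegral_prod_right' hm)

/-- The expected contribution of the walk after a first jump at time `s`. -/
def afterJump (F : (Fin (n + 2) → ℝ) → ℝ≥0∞) (x : Fin (n + 2)) (ℓ : Fin (n + 2) → ℝ) (s t : ℝ) :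
    ℝ≥0∞ :=
  (n + 1 : ℝ≥0∞)⁻¹ * ∑ c,
    ∫⁻ ω, F (ℓ + Pi.single x s + localTime (x.succAbove c) ω t) ∂walkMeasure n

lemma measurable_afterJump (hF : Measurable F) (x : Fin (n + 2)) (ℓ : Fin (n + 2) → ℝ) :
    Measurable (Function.uncurry (afterJump F x ℓ)) := by
  refine Measurable.const_mul (Finset.measurable_sum _ fun c _ => ?_) _
  exact (measurable_lintegral_shift hF (x.succAbove c)).comp
    (((measurable_add_single x ℓ).comp measurable_fst).prodMk measurable_snd)

lemma lintegral_afterJump (hF : Measurable F) (x : Fin (n + 2)) (ℓ : Fin (n + 2) → ℝ) (s : ℝ) :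
    ∫⁻ t in Ioi (0 : ℝ), afterJump F x ℓ s t
      = (n + 1 : ℝ≥0∞)⁻¹ * ∑ c, green F (x.succAbove c) (ℓ + Pi.single x s) := by
  have m : ∀ c, Measurable fun t => ∫⁻ ω, F (ℓ + Pi.single x s +
      localTime (x.succAbove c) ω t) ∂walkMeasure n := fun c =>
    (measurable_lintegral_shift hF (x.succAbove c)).comp measurable_prodMk_left
  simp only [afterJump]
  rw [lintegral_const_mul _ (Finset.measurable_sum _ fun c _ => m c),
    lintegral_finsetSum _ fun c _ => m c]
  simp only [green]

lemma lintegral_consWalk (x : Fin (n + 2)) (ℓ : Fin (n + 2) → ℝ) {s T : ℝ} (hs : 0 < s)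
    (hT : 0 < T) :
    ∫⁻ c, ∫⁻ ω, F (ℓ + localTime x (consWalk s c ω) T)
      ∂walkMeasure n ∂(PMF.uniformOfFintype (Fin (n + 1))).toMeasure
      = (if T < s then F (ℓ + Pi.single x T) else 0)
        + (if T < s then 0 else afterJump F x ℓ s (T - s)) := by
  by_cases h : T < s
  · rw [if_pos h, if_pos h, add_zero]
    have : ∀ c, ∫⁻ ω, F (ℓ + localTime x (consWalk s c ω) T) ∂walkMeasure n
        = F (ℓ + Pi.single x T) := by
      intro c
      rw [← mul_one (F (ℓ + (Pi.single x T : Fin (n + 2) → ℝ))),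
        ← measure_univ (μ := walkMeasure n), ← lintegral_const]
      refine lintegral_congr_ae ?_
      filter_upwards [ae_regularPath n] with ω hω
      rw [localTime_consWalk_of_lt x c hω hT.le h]
    simp_rw [this]
    rw [lintegral_const, measure_univ, mul_one]
  · rw [if_neg h, if_neg h, zero_add, lintegral_uniform]
    simp only [afterJump]
    congr 1
    refine Finset.sum_congr rfl fun c _ => lintegral_congr_ae ?_
    filter_upwards [ae_regularPath n] with ω hω
    rw [localTime_consWalk_of_le x c hω hs.le (not_lt.1 h), add_assoc]

lemma lintegral_Ioi_ite_rate {r T : ℝ} (hr : 0 < r) (hT : 0 < T) (a : ℝ≥0∞) :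
    ∫⁻ s in Ioi (0 : ℝ), ENNReal.ofReal (r * Real.exp (-(r * s))) * (if T < s then a else 0)
      = ENNReal.ofReal (Real.exp (-(r * T))) * a := by
  have : ∫⁻ s in Ioi T, ENNReal.ofReal (r * Real.exp (-(r * s)))
      = ENNReal.ofReal (Real.exp (-(r * T))) := by
    simp only [ENNReal.ofReal_mul hr.le]
    rw [lintegral_const_mul _ (by fun_prop), lintegral_Ioi_exp_neg_mul hr,
      ← ENNReal.ofReal_mul hr.le, mul_div_cancel₀ _ hr.ne']
  rw [← this, ← lintegral_mul_const _ (by fun_prop), ← lintegral_indicator measurableSet_Ioi,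
    ← lintegral_indicator measurableSet_Ioi]
  refine lintegral_congr fun s => ?_
  by_cases h : T < s
  · rw [indicator_of_mem (show s ∈ Ioi (0 : ℝ) from hT.trans h), if_pos h,
      indicator_of_mem (show s ∈ Ioi T from h)]
  · rw [indicator_of_notMem (show s ∉ Ioi T from h)]
    simp [h]

/-- Condition on the first jump time s. Times T < s carry the survival probability e^{-rT};
afterwards the walk restarts at a neighbour, with s added to the local time at x. -/
lemma green_first_step (hF : Measurable F) (x : Fin (n + 2)) (ℓ : Fin (n + 2) → ℝ) :
    green F x ℓ = ∫⁻ u in Ioi (0 : ℝ), ENNReal.ofReal (Real.exp (-(rate n * u))) *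
      (F (ℓ + Pi.single x u) + ENNReal.ofReal (1 - rate n) *
        ∑ c, green F (x.succAbove c) (ℓ + Pi.single x u)) := by
  let w : ℝ → ℝ≥0∞ := fun s => ENNReal.ofReal (rate n * Real.exp (-(rate n * s)))
  have hw : Measurable w := by fun_prop
  have hΦ := measurable_afterJump hF x ℓ
  have mΨ : Measurable (Function.uncurry fun s t => w s * afterJump F x ℓ s t) :=
    (hw.comp measurable_fst).mul hΦ
  have m1 : Measurable fun p : ℝ × ℝ => w p.2 * (if p.1 < p.2 then F (ℓ + Pi.single x p.1) else 0) :=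
    (hw.comp measurable_snd).mul
      (Measurable.ite (measurableSet_lt measurable_fst measurable_snd)
        (hF.comp ((measurable_add_single x ℓ).comp measurable_fst)) measurable_const)
  have e1 : green F x ℓ = ∫⁻ T in Ioi (0 : ℝ),
      (ENNReal.ofReal (Real.exp (-(rate n * T))) * F (ℓ + Pi.single x T)
        + ∫⁻ s in Ioi (0 : ℝ), (if T < s then 0 else w s * afterJump F x ℓ s (T - s))) := by
    refine setLIntegral_congr_fun measurableSet_Ioi fun T hT => ?_
    have hT : 0 < T := hT
    rw [lintegral_walkMeasure n (G := fun ω => F (ℓ + localTime x ω T)) (hF.comp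
      (measurable_const.add ((measurable_localTime x).comp
        (measurable_id.prodMk measurable_const)))),
      lintegral_expMeasure _ (measurable_lintegral_consWalk hF x ℓ T),
      ← lintegral_Ioi_ite_rate (rate_pos n) hT,
      ← lintegral_add_left (by exact m1.comp measurable_prodMk_left)]
    refine setLIntegral_congr_fun measurableSet_Ioi fun s hs => ?_
    have hs : 0 < s := hs
    simp only [lintegral_consWalk x ℓ hs hT, mul_add, w]
    congr 1
    split_ifs <;> simp
  rw [e1, lintegral_add_left (by
      refine Measurable.mul (by fun_prop) (hF.comp (measurable_add_single x ℓ))),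
    lintegral_Ioi_Ioi_sub mΨ, ← lintegral_add_left (by
      refine Measurable.mul (by fun_prop) (hF.comp (measurable_add_single x ℓ)))]
  refine lintegral_congr fun s => ?_
  have m5 : Measurable (afterJump F x ℓ s) := hΦ.of_uncurry_left
  rw [mul_add, lintegral_const_mul _ m5, lintegral_afterJump hF, ← rate_mul_inv n]
  have hring : ∀ a b c d : ℝ≥0∞, a * b * (c * d) = b * (a * c * d) := by intros; ring
  simp only [w]
  rw [ENNReal.ofReal_mul (rate_pos n).le, hring]

/-- `X` solves the first-step equation of the walk of rate `1` that jumps to a uniform vertex. -/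
def SolvesRenewal (F : (Fin (n + 2) → ℝ) → ℝ≥0∞)
    (X : Fin (n + 2) → (Fin (n + 2) → ℝ) → ℝ≥0∞) : Prop :=
  ∀ x ℓ, X x ℓ = ∫⁻ u in Ioi (0 : ℝ), ENNReal.ofReal (Real.exp (-u)) *
    (F (ℓ + Pi.single x u) + ENNReal.ofReal (1 - rate n) * ∑ y, X y (ℓ + Pi.single x u))

/-- The resolvent identity trades rate r for rate 1; its extra term is the missing summand y = x. -/
lemma solvesRenewal_green (hF : Measurable F) : SolvesRenewal F (green F) := by
  intro x ℓ
  let G : (Fin (n + 2) → ℝ) → ℝ≥0∞ := fun ℓ =>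
    F ℓ + ENNReal.ofReal (1 - rate n) * ∑ c, green F (x.succAbove c) ℓ
  have hG : Measurable G :=
    hF.add (Measurable.const_mul (Finset.measurable_sum _ fun c _ => measurable_green hF _) _)
  have h1 : ∀ ℓ, green F x ℓ = ∫⁻ u in Ioi (0 : ℝ),
      ENNReal.ofReal (Real.exp (-(rate n * u))) * G (ℓ + Pi.single x u) :=
    green_first_step hF x
  have h2 : ∀ s, ∫⁻ t in Ioi (0 : ℝ), ENNReal.ofReal (Real.exp (-(rate n * t))) *
      G (ℓ + Pi.single x (s + t)) = green F x (ℓ + Pi.single x s) := by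
    intro s
    rw [h1]
    simp_rw [Pi.single_add, add_assoc]
  rw [h1, lintegral_exp_resolvent (G := fun u => G (ℓ + (Pi.single x u : Fin (n + 2) → ℝ))) (rate_lt_one n)
    (hG.comp (measurable_add_single x ℓ))]
  simp only [h2]
  rw [← lintegral_const_mul' _ _ ENNReal.ofReal_ne_top, ← lintegral_add_left (by
    exact Measurable.mul (by fun_prop) (hG.comp (measurable_add_single x ℓ)))]
  refine lintegral_congr fun u => ?_
  simp only [G]
  rw [Fin.sum_univ_succAbove _ x]
  ring

lemma one_sub_rate_mul_card (n : ℕ) :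
    ENNReal.ofReal (1 - rate n) * ((n + 2 : ℕ) : ℝ≥0∞) = 1 := by
  rw [← ENNReal.ofReal_natCast, ← ENNReal.ofReal_mul (by linarith [rate_lt_one n]), rate,
    sub_sub_cancel, inv_mul_cancel₀ (by positivity), ENNReal.ofReal_one]

lemma sum_add_single (x : Fin (n + 2)) (ℓ : Fin (n + 2) → ℝ) (u : ℝ) :
    ∑ v, (ℓ + Pi.single x u : Fin (n + 2) → ℝ) v = ∑ v, ℓ v + u := by
  simp [Finset.sum_add_distrib]

/-- Uniqueness by contraction, phrased as a comparison since differences are unavailable in [0, ∞].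
Only X has to be bounded. -/
lemma SolvesRenewal.le {X Y : Fin (n + 2) → (Fin (n + 2) → ℝ) → ℝ≥0∞} (hX : SolvesRenewal F X)
    (hY : SolvesRenewal F Y) {D : ℝ} (hD : 0 ≤ D)
    (hb : ∀ x ℓ, X x ℓ ≤ ENNReal.ofReal (D * Real.exp (-∑ v, ℓ v))) (x : Fin (n + 2))
    (ℓ : Fin (n + 2) → ℝ) : X x ℓ ≤ Y x ℓ := by
  have key : ∀ k : ℕ, ∀ x ℓ, X x ℓ
      ≤ Y x ℓ + ENNReal.ofReal (D * (1 / 2) ^ k * Real.exp (-∑ v, ℓ v)) := by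
    intro k
    induction k with
    | zero =>
      intro x ℓ
      refine (hb x ℓ).trans ?_
      simp
    | succ k ih =>
      intro x ℓ
      -- The error at ℓ gains exp(-u) from the added local time, and ∫ exp(-2u) du = 1/2.
      have e : ∫⁻ u in Ioi (0 : ℝ), ENNReal.ofReal (Real.exp (-u)) *
          ENNReal.ofReal (D * (1 / 2) ^ k * Real.exp (-∑ v, (ℓ + Pi.single x u : Fin (n + 2) → ℝ) v))
          = ENNReal.ofReal (D * (1 / 2) ^ (k + 1) * Real.exp (-∑ v, ℓ v)) := by
        have : ∀ u : ℝ, ENNReal.ofReal (Real.exp (-u)) *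
            ENNReal.ofReal (D * (1 / 2) ^ k * Real.exp (-∑ v, (ℓ + Pi.single x u : Fin (n + 2) → ℝ) v))
            = ENNReal.ofReal (D * (1 / 2) ^ k * Real.exp (-∑ v, ℓ v)) *
              ENNReal.ofReal (Real.exp (-(2 * u))) := by
          intro u
          rw [← ENNReal.ofReal_mul (by positivity), ← ENNReal.ofReal_mul (by positivity),
            sum_add_single, neg_add, Real.exp_add, two_mul, neg_add, Real.exp_add]
          ring_nf
        simp_rw [this]
        rw [lintegral_const_mul _ (by fun_prop), lintegral_Ioi_exp_neg_mul two_pos,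
          ← ENNReal.ofReal_mul (by positivity)]
        congr 1
        simp only [mul_zero, neg_zero, Real.exp_zero]
        ring
      rw [hX x ℓ, hY x ℓ, ← e, ← lintegral_add_right _ (by
        simp_rw [sum_add_single]; fun_prop)]
      refine lintegral_mono fun u => ?_
      simp only
      rw [← mul_add]
      refine mul_le_mul_right ?_ _
      rw [add_assoc]
      refine add_le_add_right ?_ _
      have h2 := mul_le_mul_right (Finset.sum_le_sum fun y (_ : y ∈ Finset.univ) =>
        ih y (ℓ + Pi.single x u)) (ENNReal.ofReal (1 - rate n))
      refine h2.trans (le_of_eq ?_)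
      rw [Finset.sum_add_distrib, Finset.sum_const, Finset.card_univ, Fintype.card_fin, mul_add,
        nsmul_eq_mul, ← mul_assoc, one_sub_rate_mul_card, one_mul]
  have hlim : Tendsto (fun k : ℕ => Y x ℓ + ENNReal.ofReal (D * (1 / 2) ^ k *
      Real.exp (-∑ v, ℓ v))) atTop (𝓝 (Y x ℓ)) := by
    have h1 : Tendsto (fun k : ℕ => D * (1 / 2 : ℝ) ^ k * Real.exp (-∑ v, ℓ v)) atTop (𝓝 0) := by
      have := ((tendsto_pow_atTop_nhds_zero_of_lt_one (r := (1 / 2 : ℝ)) (by norm_num)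
        (by norm_num)).const_mul D).mul_const (Real.exp (-∑ v, ℓ v))
      simpa using this
    have h2 := (ENNReal.tendsto_ofReal h1).const_add (Y x ℓ)
    simpa using h2
  exact ge_of_tendsto' hlim fun k => key k x ℓ

lemma green_le {C : ℝ} (hC : 0 ≤ C) (hF : ∀ ℓ, F ℓ ≤ ENNReal.ofReal (C * Real.exp (-∑ v, ℓ v)))
    (x : Fin (n + 2)) (ℓ : Fin (n + 2) → ℝ) :
    green F x ℓ ≤ ENNReal.ofReal (C * Real.exp (-∑ v, ℓ v)) := by
  have h1 : green F x ℓ ≤ ∫⁻ T in Ioi (0 : ℝ), ENNReal.ofReal (C * Real.exp (-∑ v, ℓ v)) *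
      ENNReal.ofReal (Real.exp (-(1 * T))) := by
    refine lintegral_mono fun T => ?_
    rw [← mul_one (_ * _), ← measure_univ (μ := walkMeasure n), ← lintegral_const]
    refine lintegral_mono fun ω => (hF _).trans (le_of_eq ?_)
    simp only [Pi.add_apply]
    rw [Finset.sum_add_distrib, sum_localTime, neg_add, Real.exp_add, one_mul,
      ← ENNReal.ofReal_mul (by positivity), mul_assoc]
  refine h1.trans (le_of_eq ?_)
  rw [lintegral_const_mul _ (by fun_prop), lintegral_Ioi_exp_neg_mul one_pos]
  simp

end green

/-! ### Integration by parts for products of generating functions -/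

section ibp

variable {ι : Type*} {a : ι → ℕ → ℝ} {C : ι → ℝ}

lemma abs_prod_egf_le [Fintype ι] (ha : ∀ v m, |a v m| ≤ C v * (1 / 2) ^ m) {t : ℝ} (ht : 0 ≤ t) :
    |∏ v, egf (a v) t| ≤ (∏ v, C v) * Real.exp (Fintype.card ι / 2 * t) := by
  rw [Finset.abs_prod]
  calc _ ≤ ∏ v, C v * Real.exp (1 / 2 * t) := by
        refine Finset.prod_le_prod (fun v _ => abs_nonneg _) fun v _ => ?_
        have := abs_egf_le (ha v) t
        rwa [abs_of_nonneg ht] at this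
    _ = _ := by
        rw [Finset.prod_mul_distrib, Finset.prod_const, ← Real.exp_nat_mul, Finset.card_univ]
        ring_nf

lemma abs_prod_erase_egf_le [Fintype ι] [DecidableEq ι] (ha : ∀ v m, |a v m| ≤ C v * (1 / 2) ^ m) (y : ι) {t : ℝ}
    (ht : 0 ≤ t) :
    |egf (fun m => a y (m + 1)) t * ∏ v ∈ Finset.univ.erase y, egf (a v) t|
      ≤ (∏ v, C v) * Real.exp (Fintype.card ι / 2 * t) := by
  -- Shifting one sequence preserves its bound, so the previous estimate applies to the updated
  -- family.
  have hb : ∀ v m, |Function.update a y (fun m => a y (m + 1)) v m| ≤ C v * (1 / 2) ^ m := by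
    intro v m
    rcases eq_or_ne v y with rfl | h
    · rw [Function.update_self]
      refine (ha v (m + 1)).trans ?_
      have : 0 ≤ C v := by have := (abs_nonneg _).trans (ha v 0); simpa using this
      gcongr ?_ * ?_
      exact pow_le_pow_of_le_one (by norm_num) (by norm_num) (Nat.le_succ m)
    · rw [Function.update_of_ne h]
      exact ha v m
  have := abs_prod_egf_le hb ht
  rw [← Finset.mul_prod_erase _ _ (Finset.mem_univ y), Function.update_self] at this
  convert! this using 3
  refine Finset.prod_congr rfl fun v hv => ?_
  rw [Function.update_of_ne (Finset.ne_of_mem_erase hv)]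

lemma integrableOn_exp_mul_of_abs_le {N K : ℝ} (hN : 0 < N) {φ : ℝ → ℝ} (hφ : Continuous φ)
    (hb : ∀ t, 0 ≤ t → |φ t| ≤ K * Real.exp (N / 2 * t)) :
    IntegrableOn (fun t => Real.exp (-(N * t)) * φ t) (Ioi 0) := by
  refine Integrable.mono' ((exp_neg_integrableOn_Ioi 0 (half_pos hN)).const_mul K)
    (Continuous.aestronglyMeasurable (by fun_prop)) ?_
  filter_upwards [ae_restrict_mem measurableSet_Ioi] with t ht
  have ht : 0 < t := ht
  rw [norm_mul, Real.norm_eq_abs, Real.norm_eq_abs, abs_of_pos (Real.exp_pos _)]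
  calc _ ≤ Real.exp (-(N * t)) * (K * Real.exp (N / 2 * t)) := by
        gcongr; exact hb t ht.le
    _ = K * (Real.exp (-(N * t)) * Real.exp (N / 2 * t)) := by ring
    _ = _ := by rw [← Real.exp_add]; ring_nf

lemma continuous_prod_egf (ha : ∀ v m, |a v m| ≤ C v * (1 / 2) ^ m) (s : Finset ι) :
    Continuous fun t => ∏ v ∈ s, egf (a v) t :=
  continuous_finsetProd _ fun v _ => continuous_egf (by norm_num) (ha v)

lemma continuous_egf_succ_mul_prod [Fintype ι] [DecidableEq ι] (ha : ∀ v m, |a v m| ≤ C v * (1 / 2) ^ m) (y : ι) :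
    Continuous fun t => egf (fun m => a y (m + 1)) t * ∏ v ∈ Finset.univ.erase y, egf (a v) t :=
  (continuous_egf (by norm_num) (geom_bound_succ (ha y))).mul (continuous_prod_egf ha _)

lemma integrableOn_prod_egf [Fintype ι] [Nonempty ι] (ha : ∀ v m, |a v m| ≤ C v * (1 / 2) ^ m) :
    IntegrableOn (fun t => Real.exp (-(Fintype.card ι * t)) * ∏ v, egf (a v) t) (Ioi 0) :=
  integrableOn_exp_mul_of_abs_le (by exact_mod_cast Fintype.card_pos)
    (continuous_prod_egf ha _) fun _ ht => abs_prod_egf_le ha ht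

lemma integrableOn_prod_erase_egf [Fintype ι] [DecidableEq ι] [Nonempty ι]
    (ha : ∀ v m, |a v m| ≤ C v * (1 / 2) ^ m) (y : ι) :
    IntegrableOn (fun t => Real.exp (-(Fintype.card ι * t)) *
      (egf (fun m => a y (m + 1)) t * ∏ v ∈ Finset.univ.erase y, egf (a v) t)) (Ioi 0) :=
  integrableOn_exp_mul_of_abs_le (by exact_mod_cast Fintype.card_pos)
    (continuous_egf_succ_mul_prod ha y) fun _ ht => abs_prod_erase_egf_le ha y ht

/-- The derivative of e^{-Nt} ∏ φ_v is integrated over the half-line. The product grows at most like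
e^{Nt/2}, so there is no boundary term at infinity. -/
lemma integral_prod_egf [Fintype ι] [DecidableEq ι] [Nonempty ι]
    (ha : ∀ v m, |a v m| ≤ C v * (1 / 2) ^ m) :
    (Fintype.card ι : ℝ) * ∫ t in Ioi (0 : ℝ), Real.exp (-(Fintype.card ι * t)) * ∏ v, egf (a v) t
      = ∏ v, a v 0 + ∑ y, ∫ t in Ioi (0 : ℝ), Real.exp (-(Fintype.card ι * t)) *
        (egf (fun m => a y (m + 1)) t * ∏ v ∈ Finset.univ.erase y, egf (a v) t) := by
  set N : ℝ := ((Fintype.card ι : ℕ) : ℝ) with hN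
  have hN0 : 0 < N := by rw [hN]; exact_mod_cast Fintype.card_pos
  have i1 := integrableOn_prod_egf ha
  have i2 := fun y => integrableOn_prod_erase_egf ha y
  rw [← hN] at i1 i2
  have hd : ∀ t ∈ Ici (0 : ℝ), HasDerivAt (fun t => Real.exp (-(N * t)) * ∏ v, egf (a v) t)
      ((∑ y, Real.exp (-(N * t)) * (egf (fun m => a y (m + 1)) t *
        ∏ v ∈ Finset.univ.erase y, egf (a v) t))
        - N * (Real.exp (-(N * t)) * ∏ v, egf (a v) t)) t := by
    intro t _
    have h1 : HasDerivAt (fun t => Real.exp (-(N * t))) (Real.exp (-(N * t)) * (-N)) t := by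
      have : HasDerivAt (fun t : ℝ => -(N * t)) (-N) t := by
        simpa only [neg_mul, mul_one, id_eq] using (hasDerivAt_id t).const_mul (-N)
      exact this.exp
    have h2 := HasDerivAt.fun_finsetProd (u := Finset.univ) (f := fun v t => egf (a v) t)
      (f' := fun v => egf (fun m => a v (m + 1)) t) (x := t)
      fun v _ => hasDerivAt_egf (by norm_num) (ha v) t
    refine (h1.mul h2).congr_deriv ?_
    rw [← Finset.mul_sum]
    simp only [smul_eq_mul]
    rw [Finset.sum_congr rfl fun y _ => mul_comm _ _]
    ring
  have hlim : Tendsto (fun t => Real.exp (-(N * t)) * ∏ v, egf (a v) t) atTop (𝓝 0) := by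
    have h0 : Tendsto (fun t : ℝ => (∏ v, C v) * Real.exp (-(N / 2 * t))) atTop (𝓝 0) := by
      have : Tendsto (fun t : ℝ => N / 2 * t) atTop atTop :=
        tendsto_id.const_mul_atTop (half_pos hN0)
      simpa using (Real.tendsto_exp_neg_atTop_nhds_zero.comp this).const_mul (∏ v, C v)
    refine squeeze_zero_norm' ?_ h0
    filter_upwards [eventually_ge_atTop 0] with t ht
    rw [norm_mul, Real.norm_eq_abs, Real.norm_eq_abs, abs_of_pos (Real.exp_pos _)]
    calc _ ≤ Real.exp (-(N * t)) * ((∏ v, C v) * Real.exp (N / 2 * t)) := by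
          gcongr; exact abs_prod_egf_le ha ht
      _ = (∏ v, C v) * (Real.exp (-(N * t)) * Real.exp (N / 2 * t)) := by ring
      _ = _ := by rw [← Real.exp_add]; ring_nf
  have i3 : IntegrableOn (fun t => ∑ y, Real.exp (-(N * t)) * (egf (fun m => a y (m + 1)) t *
      ∏ v ∈ Finset.univ.erase y, egf (a v) t)) (Ioi 0) :=
    integrable_finsetSum _ fun y _ => i2 y
  have key := integral_Ioi_of_hasDerivAt_of_tendsto' hd (i3.sub (i1.const_mul N)) hlim
  rw [integral_sub i3 (i1.const_mul N), integral_const_mul, integral_finsetSum _ fun y _ => i2 y]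
    at key
  simp only [mul_zero, neg_zero, Real.exp_zero, one_mul, egf_zero] at key
  linarith

end ibp

/-! ### The explicit solution of the renewal equation -/

/-- Iterated exponential averages of `f`. -/
def iterAvg (f : ℝ → ℝ≥0∞) : ℕ → ℝ → ℝ≥0∞
  | 0 => f
  | m + 1 => fun s => ∫⁻ u in Ioi (0 : ℝ), ENNReal.ofReal (Real.exp (-u)) * iterAvg f m (s + u)

/-- The exponential generating function of a sequence in `[0, ∞]`. -/
def egfENN (β : ℕ → ℝ≥0∞) (t : ℝ) : ℝ≥0∞ :=
  ∑' m : ℕ, ENNReal.ofReal (t ^ m / (m.factorial : ℝ)) * β m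

lemma egfENN_eq {β : ℕ → ℝ≥0∞} {C ρ : ℝ} (hρ : 0 ≤ ρ) (hC : 0 ≤ C)
    (hβ : ∀ m, β m ≤ ENNReal.ofReal (C * ρ ^ m)) {t : ℝ} (ht : 0 ≤ t) :
    egfENN β t = ENNReal.ofReal (egf (fun m => (β m).toReal) t) := by
  have hb : ∀ m, |(β m).toReal| ≤ C * ρ ^ m := fun m => by
    rw [abs_of_nonneg ENNReal.toReal_nonneg]
    exact ENNReal.toReal_le_of_le_ofReal (by positivity) (hβ m)
  rw [egf, ENNReal.ofReal_tsum_of_nonneg (fun m => by positivity) (summable_egf hb t), egfENN]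
  refine tsum_congr fun m => ?_
  rw [mul_div_assoc, ENNReal.ofReal_mul ENNReal.toReal_nonneg,
    ENNReal.ofReal_toReal (ne_top_of_le_ne_top ENNReal.ofReal_ne_top (hβ m)), mul_comm]

section iterAvg

variable {f : ℝ → ℝ≥0∞}

lemma measurable_iterAvg (hf : Measurable f) (m : ℕ) : Measurable (iterAvg f m) := by
  induction m with
  | zero => exact hf
  | succ m ih =>
    refine Measurable.lintegral_prod_right' (f := fun p : ℝ × ℝ =>
      ENNReal.ofReal (Real.exp (-p.2)) * iterAvg f m (p.1 + p.2)) ?_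
    exact Measurable.mul (by fun_prop) (ih.comp (measurable_fst.add measurable_snd))

lemma iterAvg_le {C : ℝ} (hC : 0 ≤ C) (hf : ∀ s, f s ≤ ENNReal.ofReal (C * Real.exp (-s))) (m : ℕ)
    (s : ℝ) : iterAvg f m s ≤ ENNReal.ofReal (C * Real.exp (-s) * (1 / 2) ^ m) := by
  induction m generalizing s with
  | zero => simpa only [iterAvg, pow_zero, mul_one] using hf s
  | succ m ih =>
    have h1 : iterAvg f (m + 1) s ≤ ∫⁻ u in Ioi (0 : ℝ),
        ENNReal.ofReal (C * Real.exp (-s) * (1 / 2) ^ m) *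
          ENNReal.ofReal (Real.exp (-(2 * u))) := by
      refine lintegral_mono fun u => ?_
      calc ENNReal.ofReal (Real.exp (-u)) * iterAvg f m (s + u)
          ≤ ENNReal.ofReal (Real.exp (-u)) *
            ENNReal.ofReal (C * Real.exp (-(s + u)) * (1 / 2) ^ m) := by gcongr; exact ih (s + u)
        _ = _ := by
            rw [← ENNReal.ofReal_mul (by positivity), ← ENNReal.ofReal_mul (by positivity)]
            congr 1
            rw [neg_add, Real.exp_add, two_mul, neg_add, Real.exp_add]
            ring
    refine h1.trans (le_of_eq ?_)
    rw [lintegral_const_mul _ (by fun_prop), lintegral_Ioi_exp_neg_mul two_pos,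
      ← ENNReal.ofReal_mul (by positivity)]
    congr 1
    simp only [mul_zero, neg_zero, Real.exp_zero]
    ring

/-- The sum of m + 1 independent exponential variables of rate 1 has the Gamma density u^m
e^{-u}/m!. -/
lemma iterAvg_succ_eq (hf : Measurable f) (m : ℕ) (s : ℝ) :
    iterAvg f (m + 1) s = ∫⁻ u in Ioi (0 : ℝ),
      ENNReal.ofReal (u ^ m / (m.factorial : ℝ) * Real.exp (-u)) * f (s + u) := by
  induction m generalizing s with
  | zero => simp [iterAvg]
  | succ m ih =>
    let Ψ : ℝ → ℝ → ℝ≥0∞ := fun u t => ENNReal.ofReal (Real.exp (-u)) *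
      (ENNReal.ofReal (t ^ m / (m.factorial : ℝ) * Real.exp (-t)) * f (s + u + t))
    have hΨ : Measurable (Function.uncurry Ψ) := by
      refine Measurable.mul (by fun_prop) (Measurable.mul (by fun_prop) ?_)
      exact hf.comp ((measurable_const.add measurable_fst).add measurable_snd)
    have e1 : iterAvg f (m + 1 + 1) s
        = ∫⁻ u in Ioi (0 : ℝ), ∫⁻ t in Ioi (0 : ℝ), Ψ u t := by
      rw [iterAvg]
      refine lintegral_congr fun u => ?_
      rw [ih, ← lintegral_const_mul' _ _ ENNReal.ofReal_ne_top]
    rw [e1, ← lintegral_Ioi_Ioi_sub hΨ]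
    refine setLIntegral_congr_fun measurableSet_Ioi fun T hT => ?_
    have hT : 0 < T := hT
    rw [lintegral_Ioi_ite_eq_Ioc T]
    have e2 : ∫⁻ u in Ioc 0 T, Ψ u (T - u) = (∫⁻ u in Ioc 0 T,
        ENNReal.ofReal (Real.exp (-T) / (m.factorial : ℝ) * (T - u) ^ m)) * f (s + T) := by
      rw [← lintegral_mul_const _ (by fun_prop)]
      refine setLIntegral_congr_fun measurableSet_Ioc fun u hu => ?_
      have hu2 : 0 ≤ T - u := by linarith [hu.2]
      simp only [Ψ]
      rw [← mul_assoc, ← ENNReal.ofReal_mul (Real.exp_pos _).le, add_assoc, add_sub_cancel]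
      congr 2
      rw [show -T = -u + -(T - u) by ring, Real.exp_add]
      ring
    rw [e2, lintegral_Ioc_ofReal hT.le (by fun_prop) (fun u hu => by
      have hu2 : 0 ≤ T - u := by linarith [hu.2]
      positivity), intervalIntegral.integral_const_mul,
      intervalIntegral.integral_comp_sub_left (fun u => u ^ m) T, sub_self, sub_zero, integral_pow]
    congr 2
    rw [Nat.factorial_succ]
    push_cast
    have : (m : ℝ) + 1 ≠ 0 := by positivity
    field_simp
    ring

lemma measurable_egfENN_iterAvg (hf : Measurable f) (k : ℕ) :
    Measurable fun p : ℝ × ℝ => egfENN (fun m => iterAvg f (m + k) p.1) p.2 :=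
  Measurable.tsum fun m => Measurable.mul (by fun_prop)
    ((measurable_iterAvg hf (m + k)).comp measurable_fst)

/-- The shift, which is the derivative in t, coincides with the exponential average in s. -/
lemma egfENN_iterAvg_succ (hf : Measurable f) (s t : ℝ) :
    egfENN (fun m => iterAvg f (m + 1) s) t = ∫⁻ u in Ioi (0 : ℝ),
      ENNReal.ofReal (Real.exp (-u)) * egfENN (fun m => iterAvg f m (s + u)) t := by
  have hm : ∀ m, Measurable fun u => iterAvg f m (s + u) := fun m =>
    (measurable_iterAvg hf m).comp (measurable_const.add measurable_id)
  simp only [egfENN, ← ENNReal.tsum_mul_left]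
  have hm' : ∀ m, Measurable fun u => ENNReal.ofReal (Real.exp (-u)) *
      (ENNReal.ofReal (t ^ m / (m.factorial : ℝ)) * iterAvg f m (s + u)) := fun m =>
    Measurable.mul (by fun_prop) (Measurable.const_mul (hm m) _)
  rw [lintegral_tsum fun m => (hm' m).aemeasurable]
  refine tsum_congr fun m => ?_
  rw [iterAvg, ← lintegral_const_mul' _ _ ENNReal.ofReal_ne_top]
  refine lintegral_congr fun u => ?_
  ring

end iterAvg

section explicit

variable {n : ℕ} {f : ℝ → ℝ≥0∞}

/-- The Laplace integral of the product of all the single-vertex generating functions. -/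
def prodLaplace (n : ℕ) (f : ℝ → ℝ≥0∞) (ℓ : Fin (n + 2) → ℝ) : ℝ≥0∞ :=
  ((n + 2 : ℕ) : ℝ≥0∞) * ∫⁻ t in Ioi (0 : ℝ),
    ENNReal.ofReal (Real.exp (-((n + 2 : ℕ) * t))) * ∏ v, egfENN (fun m => iterAvg f m (ℓ v)) t

/-- The Laplace integral of the product of the single-vertex generating functions, differentiated
at the vertex `x`. -/
def prodLaplaceAt (f : ℝ → ℝ≥0∞) (x : Fin (n + 2)) (ℓ : Fin (n + 2) → ℝ) : ℝ≥0∞ :=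
  ((n + 2 : ℕ) : ℝ≥0∞) * ∫⁻ t in Ioi (0 : ℝ), ENNReal.ofReal (Real.exp (-((n + 2 : ℕ) * t))) *
    (egfENN (fun m => iterAvg f (m + 1) (ℓ x)) t *
      ∏ v ∈ Finset.univ.erase x, egfENN (fun m => iterAvg f m (ℓ v)) t)

/-- Tonelli: only the factor at x feels the shift by u, and its average is its derivative. -/
lemma prodLaplaceAt_eq_lintegral (hf : Measurable f) (x : Fin (n + 2)) (ℓ : Fin (n + 2) → ℝ) :
    prodLaplaceAt f x ℓ = ∫⁻ u in Ioi (0 : ℝ), ENNReal.ofReal (Real.exp (-u)) *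
      prodLaplace n f (ℓ + Pi.single x u) := by
  let R : ℝ → ℝ≥0∞ := fun t => ENNReal.ofReal (Real.exp (-((n + 2 : ℕ) * t))) *
    ∏ v ∈ Finset.univ.erase x, egfENN (fun m => iterAvg f m (ℓ v)) t
  have hphi : Measurable fun p : ℝ × ℝ => egfENN (fun m => iterAvg f m p.1) p.2 :=
    measurable_egfENN_iterAvg hf 0
  have hR : Measurable R := by
    refine Measurable.mul (by fun_prop) (Finset.measurable_prod _ fun v _ => ?_)
    exact hphi.comp measurable_prodMk_left
  have e1 : ∀ u, prodLaplace n f (ℓ + Pi.single x u) = ((n + 2 : ℕ) : ℝ≥0∞) *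
      ∫⁻ t in Ioi (0 : ℝ), R t * egfENN (fun m => iterAvg f m (ℓ x + u)) t := by
    intro u
    rw [prodLaplace]
    congr 1
    refine lintegral_congr fun t => ?_
    rw [← Finset.mul_prod_erase _ _ (Finset.mem_univ x)]
    have : ∏ v ∈ Finset.univ.erase x, egfENN (fun m => iterAvg f m
        ((ℓ + Pi.single x u : Fin (n + 2) → ℝ) v)) t
        = ∏ v ∈ Finset.univ.erase x, egfENN (fun m => iterAvg f m (ℓ v)) t := by
      refine Finset.prod_congr rfl fun v hv => ?_
      rw [Pi.add_apply, Pi.single_eq_of_ne (Finset.ne_of_mem_erase hv), add_zero]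
    rw [this, Pi.add_apply, Pi.single_eq_same]
    simp only [R]
    ring
  have hm : Measurable fun p : ℝ × ℝ => ENNReal.ofReal (Real.exp (-p.1)) *
      (R p.2 * egfENN (fun m => iterAvg f m (ℓ x + p.1)) p.2) := by
    refine Measurable.mul (by fun_prop) ((hR.comp measurable_snd).mul ?_)
    exact hphi.comp ((measurable_const.add measurable_fst).prodMk measurable_snd)
  have e2 : ∀ u, ENNReal.ofReal (Real.exp (-u)) * prodLaplace n f (ℓ + Pi.single x u)
      = ((n + 2 : ℕ) : ℝ≥0∞) * ∫⁻ t in Ioi (0 : ℝ), ENNReal.ofReal (Real.exp (-u)) *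
        (R t * egfENN (fun m => iterAvg f m (ℓ x + u)) t) := by
    intro u
    rw [e1, lintegral_const_mul' _ _ ENNReal.ofReal_ne_top]
    ring
  simp_rw [e2]
  rw [lintegral_const_mul' _ _ (ENNReal.natCast_ne_top _),
    lintegral_lintegral_swap hm.aemeasurable, prodLaplaceAt]
  congr 1
  refine lintegral_congr fun t => ?_
  rw [egfENN_iterAvg_succ hf]
  have e3 : ∀ u, ENNReal.ofReal (Real.exp (-u)) *
      (R t * egfENN (fun m => iterAvg f m (ℓ x + u)) t)
      = R t * (ENNReal.ofReal (Real.exp (-u)) * egfENN (fun m => iterAvg f m (ℓ x + u)) t) := by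
    intro u; ring
  simp_rw [e3]
  rw [lintegral_const_mul]
  · simp only [R]
    ring
  · exact Measurable.mul (by fun_prop)
      (hphi.comp ((measurable_const.add measurable_id).prodMk measurable_const))

variable {C : ℝ}

lemma iterAvg_toReal_le (hC : 0 ≤ C) (hf : ∀ s, f s ≤ ENNReal.ofReal (C * Real.exp (-s)))
    (m : ℕ) (s : ℝ) : |(iterAvg f m s).toReal| ≤ C * Real.exp (-s) * (1 / 2) ^ m := by
  rw [abs_of_nonneg ENNReal.toReal_nonneg]
  exact ENNReal.toReal_le_of_le_ofReal (by positivity) (iterAvg_le hC hf m s)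

lemma egfENN_iterAvg_eq (hC : 0 ≤ C) (hf : ∀ s, f s ≤ ENNReal.ofReal (C * Real.exp (-s)))
    (s : ℝ) {t : ℝ} (ht : 0 ≤ t) :
    egfENN (fun m => iterAvg f m s) t
      = ENNReal.ofReal (egf (fun m => (iterAvg f m s).toReal) t) :=
  egfENN_eq (by norm_num) (by positivity) (fun m => iterAvg_le hC hf m s) ht

lemma egfENN_iterAvg_succ_eq (hC : 0 ≤ C) (hf : ∀ s, f s ≤ ENNReal.ofReal (C * Real.exp (-s)))
    (s : ℝ) {t : ℝ} (ht : 0 ≤ t) :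
    egfENN (fun m => iterAvg f (m + 1) s) t
      = ENNReal.ofReal (egf (fun m => (iterAvg f (m + 1) s).toReal) t) :=
  egfENN_eq (C := C * Real.exp (-s) * (1 / 2)) (ρ := 1 / 2) (by norm_num) (by positivity)
    (fun m => (iterAvg_le hC hf (m + 1) s).trans (le_of_eq (by rw [pow_succ', mul_assoc _ (1 / 2)])))
    ht

lemma egf_iterAvg_nonneg (s : ℝ) {t : ℝ} (ht : 0 ≤ t) :
    0 ≤ egf (fun m => (iterAvg f m s).toReal) t :=
  egf_nonneg (fun _ => ENNReal.toReal_nonneg) ht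

lemma egf_iterAvg_succ_nonneg (s : ℝ) {t : ℝ} (ht : 0 ≤ t) :
    0 ≤ egf (fun m => (iterAvg f (m + 1) s).toReal) t :=
  egf_nonneg (fun _ => ENNReal.toReal_nonneg) ht

lemma prodLaplace_eq (hC : 0 ≤ C) (hf : ∀ s, f s ≤ ENNReal.ofReal (C * Real.exp (-s)))
    (ℓ : Fin (n + 2) → ℝ) :
    prodLaplace n f ℓ = ENNReal.ofReal (((n + 2 : ℕ) : ℝ) * ∫ t in Ioi (0 : ℝ),
      Real.exp (-((n + 2 : ℕ) * t)) * ∏ v, egf (fun m => (iterAvg f m (ℓ v)).toReal) t) := by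
  have hi := integrableOn_prod_egf (ι := Fin (n + 2))
    (fun v m => iterAvg_toReal_le hC hf m (ℓ v))
  rw [Fintype.card_fin] at hi
  rw [prodLaplace, ENNReal.ofReal_mul (by positivity), ENNReal.ofReal_natCast]
  rw [ofReal_integral_eq_lintegral_ofReal hi]
  · congr 1
    refine setLIntegral_congr_fun measurableSet_Ioi fun t ht => ?_
    have ht : 0 ≤ t := le_of_lt ht
    rw [ENNReal.ofReal_mul (Real.exp_pos _).le, ENNReal.ofReal_prod_of_nonneg
      fun v _ => egf_iterAvg_nonneg (ℓ v) ht]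
    congr 1
    exact Finset.prod_congr rfl fun v _ => egfENN_iterAvg_eq hC hf (ℓ v) ht
  · filter_upwards [ae_restrict_mem measurableSet_Ioi] with t ht
    exact mul_nonneg (Real.exp_pos _).le
      (Finset.prod_nonneg fun v _ => egf_iterAvg_nonneg (ℓ v) (le_of_lt ht))

lemma prodLaplaceAt_eq (hC : 0 ≤ C) (hf : ∀ s, f s ≤ ENNReal.ofReal (C * Real.exp (-s)))
    (x : Fin (n + 2)) (ℓ : Fin (n + 2) → ℝ) :
    prodLaplaceAt f x ℓ = ENNReal.ofReal (((n + 2 : ℕ) : ℝ) * ∫ t in Ioi (0 : ℝ),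
      Real.exp (-((n + 2 : ℕ) * t)) * (egf (fun m => (iterAvg f (m + 1) (ℓ x)).toReal) t *
        ∏ v ∈ Finset.univ.erase x, egf (fun m => (iterAvg f m (ℓ v)).toReal) t)) := by
  have hi := integrableOn_prod_erase_egf (ι := Fin (n + 2))
    (fun v m => iterAvg_toReal_le hC hf m (ℓ v)) x
  rw [Fintype.card_fin] at hi
  rw [prodLaplaceAt, ENNReal.ofReal_mul (by positivity), ENNReal.ofReal_natCast]
  rw [ofReal_integral_eq_lintegral_ofReal hi]
  · congr 1
    refine setLIntegral_congr_fun measurableSet_Ioi fun t ht => ?_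
    have ht : 0 ≤ t := le_of_lt ht
    rw [ENNReal.ofReal_mul (Real.exp_pos _).le, ENNReal.ofReal_mul
      (egf_iterAvg_succ_nonneg (ℓ x) ht), ENNReal.ofReal_prod_of_nonneg
      fun v _ => egf_iterAvg_nonneg (ℓ v) ht]
    congr 2
    · exact egfENN_iterAvg_succ_eq hC hf (ℓ x) ht
    · exact Finset.prod_congr rfl fun v _ => egfENN_iterAvg_eq hC hf (ℓ v) ht
  · filter_upwards [ae_restrict_mem measurableSet_Ioi] with t ht
    exact mul_nonneg (Real.exp_pos _).le (mul_nonneg (egf_iterAvg_succ_nonneg (ℓ x) (le_of_lt ht))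
      (Finset.prod_nonneg fun v _ => egf_iterAvg_nonneg (ℓ v) (le_of_lt ht)))

lemma one_sub_rate_mul (n : ℕ) (z : ℝ) : (1 - rate n) * (((n + 2 : ℕ) : ℝ) * z) = z := by
  rw [rate, sub_sub_cancel, ← mul_assoc, inv_mul_cancel₀ (by positivity), one_mul]

/-- Integration by parts in t. The boundary term at 0 is the source of the renewal equation, and 1 -
rate = 1/N cancels the prefactor of `prodLaplaceAt`. -/
lemma prodLaplace_eq_add_sum (hC : 0 ≤ C) (hf : ∀ s, f s ≤ ENNReal.ofReal (C * Real.exp (-s)))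
    (ℓ : Fin (n + 2) → ℝ) :
    prodLaplace n f ℓ = ∏ v, f (ℓ v) + ENNReal.ofReal (1 - rate n) * ∑ y, prodLaplaceAt f y ℓ := by
  have key := integral_prod_egf (ι := Fin (n + 2)) (fun v m => iterAvg_toReal_le hC hf m (ℓ v))
  rw [Fintype.card_fin] at key
  rw [prodLaplace_eq hC hf, key]
  have hpos : ∀ y : Fin (n + 2), 0 ≤ ∫ t in Ioi (0 : ℝ), Real.exp (-((n + 2 : ℕ) * t)) *
      (egf (fun m => (iterAvg f (m + 1) (ℓ y)).toReal) t *
        ∏ v ∈ Finset.univ.erase y, egf (fun m => (iterAvg f m (ℓ v)).toReal) t) := by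
    intro y
    refine setIntegral_nonneg measurableSet_Ioi fun t ht => ?_
    exact mul_nonneg (Real.exp_pos _).le (mul_nonneg (egf_iterAvg_succ_nonneg (ℓ y) (le_of_lt ht))
      (Finset.prod_nonneg fun v _ => egf_iterAvg_nonneg (ℓ v) (le_of_lt ht)))
  rw [ENNReal.ofReal_add (Finset.prod_nonneg fun v _ => ENNReal.toReal_nonneg)
    (Finset.sum_nonneg fun y _ => hpos y),
    ENNReal.ofReal_prod_of_nonneg fun v _ => ENNReal.toReal_nonneg,
    ENNReal.ofReal_sum_of_nonneg fun y _ => hpos y, Finset.mul_sum]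
  congr 1
  · refine Finset.prod_congr rfl fun v _ => ?_
    exact ENNReal.ofReal_toReal (ne_top_of_le_ne_top ENNReal.ofReal_ne_top (hf (ℓ v)))
  · refine Finset.sum_congr rfl fun y _ => ?_
    rw [prodLaplaceAt_eq hC hf, ← ENNReal.ofReal_mul (by linarith [rate_lt_one n]),
      one_sub_rate_mul]

lemma solvesRenewal_prodLaplaceAt (hm : Measurable f) (hC : 0 ≤ C)
    (hf : ∀ s, f s ≤ ENNReal.ofReal (C * Real.exp (-s))) :
    SolvesRenewal (n := n) (fun ℓ => ∏ v, f (ℓ v)) (prodLaplaceAt f) := by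
  intro x ℓ
  rw [prodLaplaceAt_eq_lintegral hm]
  simp_rw [← prodLaplace_eq_add_sum hC hf]

lemma prodLaplaceAt_le (hC : 0 ≤ C) (hf : ∀ s, f s ≤ ENNReal.ofReal (C * Real.exp (-s)))
    (x : Fin (n + 2)) (ℓ : Fin (n + 2) → ℝ) :
    prodLaplaceAt f x ℓ ≤ ENNReal.ofReal (2 * C ^ (n + 2) * Real.exp (-∑ v, ℓ v)) := by
  rw [prodLaplaceAt_eq hC hf]
  refine ENNReal.ofReal_le_ofReal ?_
  have hN : (0 : ℝ) < ((n + 2 : ℕ) : ℝ) := by positivity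
  have hi := integrableOn_prod_erase_egf (ι := Fin (n + 2))
    (fun v m => iterAvg_toReal_le hC hf m (ℓ v)) x
  rw [Fintype.card_fin] at hi
  have hprod : ∏ v, C * Real.exp (-ℓ v) = C ^ (n + 2) * Real.exp (-∑ v, ℓ v) := by
    rw [Finset.prod_mul_distrib, Finset.prod_const, Finset.card_univ, Fintype.card_fin,
      ← Real.exp_sum, Finset.sum_neg_distrib]
  have h1 := integral_pow_mul_exp_neg_mul 0 (half_pos hN)
  have i1 := integrableOn_pow_mul_exp_neg_mul 0 (half_pos hN)
  simp only [pow_zero, one_mul, Nat.factorial_zero, Nat.cast_one, zero_add, pow_one] at h1 i1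
  have h2 := setIntegral_mono_on hi (i1.const_mul (C ^ (n + 2) * Real.exp (-∑ v, ℓ v)))
    measurableSet_Ioi (fun t ht => ?_)
  · rw [integral_const_mul, h1] at h2
    calc _ ≤ ((n + 2 : ℕ) : ℝ) * (C ^ (n + 2) * Real.exp (-∑ v, ℓ v) *
          (1 / (((n + 2 : ℕ) : ℝ) / 2))) := by gcongr
      _ = _ := by field_simp
  · have ht : 0 < t := ht
    have h3 := (le_abs_self _).trans (abs_prod_erase_egf_le (ι := Fin (n + 2))
      (fun v m => iterAvg_toReal_le hC hf m (ℓ v)) x ht.le)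
    rw [hprod, Fintype.card_fin] at h3
    calc _ ≤ Real.exp (-(((n + 2 : ℕ) : ℝ) * t)) * (C ^ (n + 2) * Real.exp (-∑ v, ℓ v) *
          Real.exp (((n + 2 : ℕ) : ℝ) / 2 * t)) := by gcongr
      _ = C ^ (n + 2) * Real.exp (-∑ v, ℓ v) * (Real.exp (-(((n + 2 : ℕ) : ℝ) * t)) *
          Real.exp (((n + 2 : ℕ) : ℝ) / 2 * t)) := by ring
      _ = _ := by rw [← Real.exp_add]; ring_nf

/-- Both sides solve the same equation and both are bounded by a multiple of exp(-Σℓ), so the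
comparison runs in both directions. -/
lemma green_prod_eq (hm : Measurable f) (hC : 0 ≤ C)
    (hf : ∀ s, f s ≤ ENNReal.ofReal (C * Real.exp (-s))) (x : Fin (n + 2))
    (ℓ : Fin (n + 2) → ℝ) :
    green (fun ℓ => ∏ v, f (ℓ v)) x ℓ = prodLaplaceAt f x ℓ := by
  have hF : Measurable fun ℓ : Fin (n + 2) → ℝ => ∏ v, f (ℓ v) :=
    Finset.measurable_prod _ fun v _ => hm.comp (measurable_pi_apply v)
  have hFb : ∀ ℓ : Fin (n + 2) → ℝ, ∏ v, f (ℓ v)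
      ≤ ENNReal.ofReal (C ^ (n + 2) * Real.exp (-∑ v, ℓ v)) := by
    intro ℓ
    have : C ^ (n + 2) * Real.exp (-∑ v, ℓ v) = ∏ v, C * Real.exp (-ℓ v) := by
      rw [Finset.prod_mul_distrib, Finset.prod_const, Finset.card_univ, Fintype.card_fin,
        ← Real.exp_sum, Finset.sum_neg_distrib]
    rw [this, ENNReal.ofReal_prod_of_nonneg fun v _ => by positivity]
    exact Finset.prod_le_prod' fun v _ => hf (ℓ v)
  refine le_antisymm ?_ ?_
  · exact (solvesRenewal_green hF).le (solvesRenewal_prodLaplaceAt hm hC hf) (by positivity)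
      (green_le (by positivity) hFb) x ℓ
  · exact (solvesRenewal_prodLaplaceAt hm hC hf).le (solvesRenewal_green hF) (by positivity)
      (prodLaplaceAt_le hC hf) x ℓ

end explicit

/-! ### The susceptibility as a Laplace integral -/

/-- The single-vertex weight, with values in `[0, ∞]`. -/
def vertexWeight (g ν s : ℝ) : ℝ≥0∞ := ENNReal.ofReal (Real.exp (-g * s ^ 2 - ν * s))

lemma measurable_vertexWeight (g ν : ℝ) : Measurable (vertexWeight g ν) := by
  unfold vertexWeight; fun_prop

lemma vertexWeight_le {g : ℝ} (hg : 0 < g) (ν s : ℝ) :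
    vertexWeight g ν s ≤ ENNReal.ofReal (weightConst g ν * Real.exp (-s)) :=
  ENNReal.ofReal_le_ofReal (weight_le hg ν s)

lemma iterAvg_vertexWeight_zero {g : ℝ} (hg : 0 < g) (ν : ℝ) (m : ℕ) :
    (iterAvg (vertexWeight g ν) m 0).toReal = coeff g ν m := by
  cases m with
  | zero => simp [iterAvg, vertexWeight, coeff]
  | succ m =>
    have hi := (integrableOn_wmoment hg ν m).div_const (m.factorial : ℝ)
    have hnn : 0 ≤ᵐ[volume.restrict (Ioi (0 : ℝ))] fun s : ℝ =>
        s ^ m * Real.exp (-g * s ^ 2 - (ν + 1) * s) / (m.factorial : ℝ) := by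
      filter_upwards [ae_restrict_mem measurableSet_Ioi] with s hs
      have hs : 0 < s := hs
      simp only [Pi.zero_apply]
      positivity
    have e : iterAvg (vertexWeight g ν) (m + 1) 0 = ENNReal.ofReal (coeff g ν (m + 1)) := by
      rw [iterAvg_succ_eq (measurable_vertexWeight g ν), coeff, wmoment, ← integral_div,
        ofReal_integral_eq_lintegral_ofReal hi hnn]
      refine setLIntegral_congr_fun measurableSet_Ioi fun s hs => ?_
      have hs : 0 < s := hs
      rw [vertexWeight, zero_add, ← ENNReal.ofReal_mul (by positivity)]
      congr 1
      rw [show -g * s ^ 2 - (ν + 1) * s = -s + (-g * s ^ 2 - ν * s) by ring, Real.exp_add]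
      ring
    rw [e, ENNReal.toReal_ofReal (coeff_pos hg ν _).le]

/-- The weight of the walk up to time `T`, restricted to the walks that end at `y`. -/
def pathWeight {n : ℕ} (g : ℝ) (x y : Fin (n + 2)) (T : ℝ) (ω : WalkSpace n) : ℝ≥0∞ :=
  ENNReal.ofReal
    (Real.exp (-g * ∑ v, localTime x ω T v ^ 2) * if walk x ω T = y then 1 else 0)

lemma measurable_pathWeight {n : ℕ} (g : ℝ) (x y : Fin (n + 2)) :
    Measurable (Function.uncurry (pathWeight g x y)) := by
  have hL : Measurable fun p : ℝ × WalkSpace n => localTime x p.2 p.1 :=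
    (measurable_localTime x).comp measurable_swap
  have hS : Measurable fun p : ℝ × WalkSpace n =>
      Real.exp (-g * ∑ v, localTime x p.2 p.1 v ^ 2) := by
    have : ∀ v, Measurable fun p : ℝ × WalkSpace n => localTime x p.2 p.1 v := fun v =>
      (measurable_pi_apply v).comp hL
    fun_prop
  exact ENNReal.measurable_ofReal.comp
    (hS.mul ((measurable_walk_indicator x y).comp measurable_swap))

lemma sum_pathWeight {n : ℕ} (g : ℝ) (x : Fin (n + 2)) (T : ℝ) (ω : WalkSpace n) :
    ∑ y, pathWeight g x y T ω = ENNReal.ofReal (Real.exp (-g * ∑ v, localTime x ω T v ^ 2)) := by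
  simp only [pathWeight]
  rw [Finset.sum_eq_single (walk x ω T) (fun y _ hy => by simp [hy.symm])
    (fun h => absurd (Finset.mem_univ _) h)]
  simp

lemma sum_twoPoint (n : ℕ) (g ν : ℝ) (x : Fin (n + 2)) :
    ∑ y, twoPoint n g ν x y = green (fun ℓ => ∏ v, vertexWeight g ν (ℓ v)) x 0 := by
  have hm : ∀ y, Measurable fun T : ℝ => (∫⁻ ω, pathWeight g x y T ω ∂walkMeasure n) *
      ENNReal.ofReal (Real.exp (-ν * T)) := fun y =>
    Measurable.mul (Measurable.lintegral_prod_right (measurable_pathWeight g x y)) (by fun_prop)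
  have e : ∀ y, twoPoint n g ν x y = ∫⁻ T in Ioi (0 : ℝ),
      (∫⁻ ω, pathWeight g x y T ω ∂walkMeasure n) * ENNReal.ofReal (Real.exp (-ν * T)) :=
    fun y => by simp only [twoPoint, pathWeight]
  simp only [e]
  rw [← lintegral_finsetSum _ fun y _ => hm y, green]
  refine lintegral_congr fun T => ?_
  rw [← Finset.sum_mul, ← lintegral_finsetSum _ fun y _ =>
    (measurable_pathWeight g x y).of_uncurry_left,
    ← lintegral_mul_const' _ _ ENNReal.ofReal_ne_top]
  refine lintegral_congr fun ω => ?_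
  rw [sum_pathWeight, ← ENNReal.ofReal_mul (Real.exp_pos _).le, ← Real.exp_add]
  simp only [vertexWeight, zero_add]
  rw [← ENNReal.ofReal_prod_of_nonneg fun v _ => (Real.exp_pos _).le, ← Real.exp_sum,
    Finset.sum_sub_distrib, ← Finset.mul_sum, ← Finset.mul_sum, sum_localTime]
  ring_nf

lemma prodLaplaceAt_zero_eq {n : ℕ} (f : ℝ → ℝ≥0∞) (x y : Fin (n + 2)) :
    prodLaplaceAt f x 0 = prodLaplaceAt f y 0 := by
  simp [prodLaplaceAt, Finset.prod_const, Finset.card_erase_of_mem]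

/-- At ℓ = 0 all vertices are alike, so the average over y reduces to its value at x; the summand 1
is ∏ f(0). Finiteness of the two-point function comes for free. -/
lemma sum_twoPoint_add_one {g : ℝ} (hg : 0 < g) (n : ℕ) (ν : ℝ) (x : Fin (n + 2)) :
    1 + ∑ y, twoPoint n g ν x y = ENNReal.ofReal (((n + 2 : ℕ) : ℝ) * ∫ t in Ioi (0 : ℝ),
      Real.exp (-((n + 2 : ℕ) * t)) * egf (coeff g ν) t ^ (n + 2)) := by
  have hC := (weightConst_pos g ν).le
  have h1 := prodLaplace_eq_add_sum (n := n) hC (vertexWeight_le hg ν) 0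
  rw [prodLaplace_eq hC (vertexWeight_le hg ν), Finset.sum_congr rfl fun y _ =>
    prodLaplaceAt_zero_eq (vertexWeight g ν) y x, Finset.sum_const, Finset.card_univ,
    Fintype.card_fin, nsmul_eq_mul, ← mul_assoc, one_sub_rate_mul_card, one_mul] at h1
  rw [sum_twoPoint, green_prod_eq (measurable_vertexWeight g ν) hC (vertexWeight_le hg ν)]
  simp only [Pi.zero_apply, iterAvg_vertexWeight_zero hg, Finset.prod_const, Finset.card_univ,
    Fintype.card_fin] at h1
  rw [h1]
  simp [vertexWeight]

lemma twoPoint_ne_top {g : ℝ} (hg : 0 < g) (n : ℕ) (ν : ℝ) (x y : Fin (n + 2)) :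
    twoPoint n g ν x y ≠ ∞ := by
  have h := sum_twoPoint_add_one hg n ν x
  have h2 : twoPoint n g ν x y ≤ 1 + ∑ y, twoPoint n g ν x y :=
    (Finset.single_le_sum_of_canonicallyOrdered (Finset.mem_univ y)).trans le_add_self
  rw [h] at h2
  exact ne_top_of_le_ne_top ENNReal.ofReal_ne_top h2

lemma susceptibility_eq {g : ℝ} (hg : 0 < g) (n : ℕ) (ν : ℝ) :
    susceptibility n g ν = ((n + 2 : ℕ) : ℝ) * (∫ t in Ioi (0 : ℝ),
      Real.exp (-((n + 2 : ℕ) * t)) * egf (coeff g ν) t ^ (n + 2)) - 1 := by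
  have h := sum_twoPoint_add_one hg n ν 0
  have hne : ∑ y, twoPoint n g ν 0 y ≠ ∞ :=
    ENNReal.sum_ne_top.2 fun y _ => twoPoint_ne_top hg n ν 0 y
  have hpos : 0 ≤ ((n + 2 : ℕ) : ℝ) * ∫ t in Ioi (0 : ℝ),
      Real.exp (-((n + 2 : ℕ) * t)) * egf (coeff g ν) t ^ (n + 2) := by
    refine mul_nonneg (by positivity) (setIntegral_nonneg measurableSet_Ioi fun t ht => ?_)
    have := one_le_egf_coeff hg ν (le_of_lt ht)
    positivity
  rw [susceptibility, ← ENNReal.toReal_sum fun y _ => twoPoint_ne_top hg n ν 0 y]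
  have h2 := congrArg ENNReal.toReal h
  rw [ENNReal.toReal_add ENNReal.one_ne_top hne, ENNReal.toReal_one,
    ENNReal.toReal_ofReal hpos] at h2
  linarith

lemma tendsto_susceptibility {g : ℝ} (hg : 0 < g) {ν : ℝ} (hν : wmoment g ν 0 = 1) (s : ℝ) :
    Tendsto (fun n : ℕ => ((n + 2 : ℕ) : ℝ) ^ (-(1 / 2) : ℝ) *
        susceptibility n g (ν + s * ((n + 2 : ℕ) : ℝ) ^ (-(1 / 2) : ℝ))) atTop
      (𝓝 (1 / √(1 / 2 * (1 - wmoment g ν 1)) *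
        profile0 (wmoment g ν 1 * s / √(1 / 2 * (1 - wmoment g ν 1))))) := by
  have h1 := (tendsto_add_atTop_iff_nat 2).2 (tendsto_laplace hg hν s)
  -- The 1 subtracted in the exact formula vanishes after multiplication by N^{-1/2}.
  have h2 : Tendsto (fun n : ℕ => (√((n + 2 : ℕ) : ℝ))⁻¹) atTop (𝓝 0) :=
    ((Real.tendsto_sqrt_atTop.comp tendsto_natCast_atTop_atTop).comp
      (tendsto_add_atTop_nat 2)).inv_tendsto_atTop
  have h3 := h1.sub h2
  rw [sub_zero] at h3
  refine h3.congr fun n => ?_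
  have hN : (0 : ℝ) < ((n + 2 : ℕ) : ℝ) := by positivity
  have e : ((n + 2 : ℕ) : ℝ) ^ (-(1 / 2) : ℝ) = (√((n + 2 : ℕ) : ℝ))⁻¹ := by
    rw [Real.rpow_neg hN.le, Real.sqrt_eq_rpow]
  rw [e, susceptibility_eq hg, mul_sub, mul_one, ← mul_assoc]
  congr 2
  rw [inv_mul_eq_div, Real.div_sqrt]

end

/-! ### The theorem -/

theorem proposition1p6 (g : ℝ) (hg : 0 < g) :
    -- the two-point function is finite, so that the susceptibility is well defined
    (∀ (n : ℕ) (ν : ℝ) (x y : Fin (n + 2)), twoPoint n g ν x y ≠ ∞) ∧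
    -- the critical point exists and is unique
    (∃! ν : ℝ, IsCriticalPoint g ν) ∧
    ∀ νc : ℝ, IsCriticalPoint g νc →
      ∃ l₁ l₂ : ℝ, 0 < l₁ ∧ 0 < l₂ ∧
        l₁ = 1 / √(1 / 2 * ddV0 g νc) ∧
        l₂ = deriv (fun ν => dV0 g ν) νc / √(1 / 2 * ddV0 g νc) ∧
        ∀ s : ℝ,
          Tendsto
            (fun n : ℕ => ((n + 2 : ℕ) : ℝ) ^ (-(1 / 2) : ℝ) *
              susceptibility n g (νc + s * ((n + 2 : ℕ) : ℝ) ^ (-(1 / 2) : ℝ)))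
            atTop (𝓝 (l₁ * profile0 (l₂ * s))) := by
  refine ⟨twoPoint_ne_top hg, existsUnique_isCriticalPoint hg, fun νc hc => ?_⟩
  have hν := (isCriticalPoint_iff hg νc).1 hc
  have hpos : 0 < √(1 / 2 * ddV0 g νc) := Real.sqrt_pos.2 (by have := hc.2; positivity)
  refine ⟨_, _, by positivity, ?_, rfl, rfl, fun s => ?_⟩
  · rw [deriv_dV0 hg]
    exact div_pos (wmoment_pos hg νc 1) hpos
  · have h := tendsto_susceptibility hg hν s
    rw [deriv_dV0 hg, ddV0_eq hg, hν, one_pow, div_mul_eq_mul_div (wmoment g νc 1)]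
    exact h
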